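/- **Setting.** Let $U\subseteq\mathbb R^d\times\mathbb R^d$ be open, with coordinates $(q,p)$ and Poisson bracket $[F,G]=\sum_i\left(\frac{\partial F}{\partial q_i}\frac{\partial G}{\partial p_i}-\frac{\partial F}{\partial p_i}\frac{\partial G}{\partial q_i}\right)$, and write $L_GF=[F,G]$. Let $H_0$ be a Hamiltonian on $U$ with complete Hamiltonian flow $\Phi_t$ ($\dot q=\partial H_0/\partial p$, $\dot p=-\partial H_0/\partial q$). Let $\mathcal A$ be an algebra of real analytic functions on $U$ that contains the constants and $H_0$ and is closed under the Poisson bracket. Assume that for $F\in\mathcal A$ and $x\in U$ the function $e^{-\lambda t}F(\Phi_t x)$ is integrable on $(0,\infty)$ for every $\lambda>0$, that the averaging and integrating operators $$(PF)(x)=\lim_{\lambda\to+0}\lambda\int_0^\infty e^{-\lambda t}F(\Phi_tx)\,dt,\qquad (SF)(x)=-\lim_{\lambda\to+0}\int_0^\infty e^{-\lambda t}(F-PF)(\Phi_tx)\,dt$$ exist on $\mathcal A$, and that they map $\mathcal A$ into $\mathcal A$. Let $H_i\in\mathcal A$ and $H=H_0+\alpha H_i$. All series below are formal power series in $\alpha$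 with coefficients in $\mathcal A$; the bracket and all operators are extended $\alpha$-linearly to $\mathcal A[[\alpha]]$. Put $S^{(0)}=-P$, $S^{(k)}=S^k$ for $k\ge1$, and define the perturbed averaging and integrating operators by the Kato series $$P_H=\sum_{n\ge0}(-1)^{n+1}\alpha^n\!\!\sum_{p_1+\dots+p_{n+1}=n}\!\! S^{(p_{n+1})}L_{H_i}S^{(p_n)}\cdots L_{H_i}S^{(p_1)},$$ $$S_H=\sum_{n\ge0}(-1)^{n}\alpha^n\!\!\sum_{p_1+\dots+p_{n+1}=n+1}\!\! S^{(p_{n+1})}L_{H_i}S^{(p_n)}\cdots L_{H_i}S^{(p_1)},$$ with $p_j\ge0$ integers. For $F\in\mathcal A[[\alpha]]$ (the normalization style) let $G=-S_HH_i+P_HF=\sum_n\alpha^nG_n$. Let $U_G=\sum_n\alpha^nU_n$ be the Lie transform with generator $G$ and $V_G=\sum_n\alpha^nV_n$ its inverse: $U_0=V_0=1$, $U_n=\frac1n\sum_{k<n}L_{G_{n-k-1}}U_k$, $V_n=-\frac1n\sum_{k<n}V_kL_{G_{n-k-1}}$. Let $\widetilde H=V_GH$ be the normalized Hamiltonian.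 **Theorem.** Let $\tilde I\in\mathcal A$ belong to the centre of the algebra of integrals of the unperturbed system, that is, $[\tilde I,H_0]=0$ and $[\tilde I,J]=0$ for every $J\in\mathcal A$ with $[J,H_0]=0$. Then $P\tilde I=\tilde I$, and $[\tilde I,PK]=0$ for all $K\in\mathcal A$. For every style $F\in\mathcal A[[\alpha]]$, the Gustavson integral $I=I(\alpha)=U_G\tilde I$ satisfies: 1. $[\tilde I,\widetilde H]=0$; 2. $I=P_HI$; 3. $[I,P_HK]=0$ for all $K\in\mathcal A[[\alpha]]$; 4. $[I,H]=0$, i.e. $I$ is a formal integral of the perturbed system; 5. $\dfrac{\partial I}{\partial\alpha}=-L_{S_HH_i}I$. Moreover $I$ does not depend on the style: any two $F,F'\in\mathcal A[[\alpha]]$ give the same series $I$. -/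

import Mathlib

open Filter Topology MeasureTheory

noncomputable section

namespace KatoMech

/-- The phase space `ℝ^d × ℝ^d`; a point is the pair `(q, p)`. -/
abbrev Phase (d : ℕ) : Type := (Fin d → ℝ) × (Fin d → ℝ)

/-- Extension by zero of a function given on an open set of phase space. Only its values near
points of the (open) set are ever used. -/
def ext {d : ℕ} {U : TopologicalSpace.Opens (Phase d)} (F : U → ℝ) : Phase d → ℝ :=
  Function.extend Subtype.val F 0

/-- `∂F/∂q_i` -/
def dq {d : ℕ} {U : TopologicalSpace.Opens (Phase d)} (F : U → ℝ) (i : Fin d) (x : U) : ℝ :=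
  fderiv ℝ (ext F) x (Pi.single i 1, 0)

/-- `∂F/∂p_i` -/
def dp {d : ℕ} {U : TopologicalSpace.Opens (Phase d)} (F : U → ℝ) (i : Fin d) (x : U) : ℝ :=
  fderiv ℝ (ext F) x (0, Pi.single i 1)

/-- The canonical Poisson bracket
`[F, G] = ∑ i, (∂F/∂q_i ∂G/∂p_i - ∂F/∂p_i ∂G/∂q_i)`. -/
def poisson {d : ℕ} {U : TopologicalSpace.Opens (Phase d)} (F G : U → ℝ) : U → ℝ :=
  fun x => ∑ i, (dq F i x * dp G i x - dp F i x * dq G i x)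

/-- `Φ` is the (complete) Hamiltonian flow of `H`: `q' = ∂H/∂p`, `p' = - ∂H/∂q`. -/
structure IsHamiltonianFlow {d : ℕ} {U : TopologicalSpace.Opens (Phase d)}
    (H : U → ℝ) (Φ : Flow ℝ U) : Prop where
  deriv_q : ∀ (x : U) (t : ℝ) (i : Fin d),
    HasDerivAt (fun s : ℝ => (Φ s x : Phase d).1 i) (dp H i (Φ t x)) t
  deriv_p : ∀ (x : U) (t : ℝ) (i : Fin d),
    HasDerivAt (fun s : ℝ => (Φ s x : Phase d).2 i) (-(dq H i (Φ t x))) t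

/-- The Laplace transform `∫₀^∞ e^{-lam t} F(Φ_t x) dt` of `F` along the orbit of `x`. -/
def laplace {d : ℕ} {U : TopologicalSpace.Opens (Phase d)} (Φ : Flow ℝ U) (F : U → ℝ) (x : U)
    (lam : ℝ) : ℝ :=
  ∫ t in Set.Ioi (0 : ℝ), Real.exp (-lam * t) * F (Φ t x)

/-- The Abel time average `lim_{lam → +0} lam ∫₀^∞ e^{-lam t} F(Φ_t x) dt`. -/
def abelAvg {d : ℕ} {U : TopologicalSpace.Opens (Phase d)} (Φ : Flow ℝ U) (F : U → ℝ) : U → ℝ :=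
  fun x => limUnder (𝓝[>] (0 : ℝ)) (fun lam => lam * laplace Φ F x lam)

/-- The zero-mean antiderivative
`- lim_{lam → +0} ∫₀^∞ e^{-lam t} (F - ⟨F⟩)(Φ_t x) dt`, with `⟨F⟩` the Abel time average. -/
def abelInt {d : ℕ} {U : TopologicalSpace.Opens (Phase d)} (Φ : Flow ℝ U) (F : U → ℝ) : U → ℝ :=
  fun x => - limUnder (𝓝[>] (0 : ℝ)) (fun lam => laplace Φ (F - abelAvg Φ F) x lam)

/-- An unperturbed Hamiltonian system on an open set of phase space, with an algebra of analytic
functions on which the perturbation theory is carried out: it contains `H₀`, is closed under the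
Poisson bracket, and the Abel averages that define the averaging and the integrating operator
exist on it and do not lead out of it. -/
structure UnperturbedSystem (d : ℕ) where
  /-- the phase space region -/
  domain : TopologicalSpace.Opens (Phase d)
  /-- the unperturbed Hamiltonian -/
  H₀ : domain → ℝ
  /-- the Hamiltonian flow of `H₀` -/
  flow : Flow ℝ domain
  isHamiltonianFlow : IsHamiltonianFlow H₀ flow
  /-- the functions under consideration -/
  obs : Subalgebra ℝ (domain → ℝ)
  H₀_mem : H₀ ∈ obs
  analytic : ∀ F ∈ obs, ∀ x : domain, AnalyticAt ℝ (ext F) x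
  poisson_mem : ∀ F ∈ obs, ∀ G ∈ obs, poisson F G ∈ obs
  integrable : ∀ F ∈ obs, ∀ (x : domain) (lam : ℝ), 0 < lam →
    IntegrableOn (fun t : ℝ => Real.exp (-lam * t) * F (flow t x)) (Set.Ioi 0)
  exists_avg : ∀ F ∈ obs, ∀ x : domain,
    ∃ l : ℝ, Tendsto (fun lam => lam * laplace flow F x lam) (𝓝[>] 0) (𝓝 l)
  avg_mem : ∀ F ∈ obs, abelAvg flow F ∈ obs
  exists_int : ∀ F ∈ obs, ∀ x : domain,
    ∃ l : ℝ, Tendsto (fun lam => laplace flow (F - abelAvg flow F) x lam) (𝓝[>] 0) (𝓝 l)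
  int_mem : ∀ F ∈ obs, abelInt flow F ∈ obs

namespace UnperturbedSystem

variable {d : ℕ} (sys : UnperturbedSystem d)

/-- The functions of the system. -/
abbrev Obs : Type := sys.obs

/-- Formal power series in the perturbation parameter `α` with functions as coefficients.
The parameter `α` is `PowerSeries.X`. -/
abbrev Series : Type := PowerSeries sys.Obs

/-- `H₀` as an element of the algebra of functions. -/
def h₀ : sys.Obs := ⟨sys.H₀, sys.H₀_mem⟩

/-- The Poisson bracket `[F, G]` of two functions. -/
def br (F G : sys.Obs) : sys.Obs := ⟨poisson F.1 G.1, sys.poisson_mem F.1 F.2 G.1 G.2⟩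

/-- The Liouville operator `L_G F = [F, G]`. -/
def L (G F : sys.Obs) : sys.Obs := sys.br F G

/-- The unperturbed averaging operator `P = P_{H₀}`. -/
def P (F : sys.Obs) : sys.Obs := ⟨abelAvg sys.flow F.1, sys.avg_mem F.1 F.2⟩

/-- The unperturbed integrating operator `S = S_{H₀}`. -/
def S (F : sys.Obs) : sys.Obs := ⟨abelInt sys.flow F.1, sys.int_mem F.1 F.2⟩

/-- `F` is an integral of motion of the unperturbed system. -/
def IsIntegral (F : sys.Obs) : Prop := sys.br F sys.h₀ = 0

/-- `I` belongs to the centre of the algebra of integrals of the unperturbed system. -/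
def IsCentralIntegral (I : sys.Obs) : Prop :=
  sys.IsIntegral I ∧ ∀ J : sys.Obs, sys.IsIntegral J → sys.br I J = 0

/-- The Laurent coefficients of the unperturbed resolvent: `S^(0) = -P`, and `S^(k) = S^k` for
`k ≥ 1`. -/
def Sr (k : ℕ) (F : sys.Obs) : sys.Obs := if k = 0 then -(sys.P F) else sys.S^[k] F

/-- The product `S^(p_n) L_{Hi} S^(p_{n-1}) ⋯ L_{Hi} S^(p_0)`, with `n` factors `L_{Hi}`. -/
def katoWord (Hi : sys.Obs) : (n : ℕ) → (Fin (n + 1) → ℕ) → sys.Obs → sys.Obs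
  | 0, p, F => sys.Sr (p 0) F
  | n + 1, p, F => sys.Sr (p (Fin.last (n + 1)))
      (sys.L Hi (katoWord Hi n (fun i => p i.castSucc) F))

/-- The sum of all Kato products with `n` factors `L_{Hi}` and `p_0 + ⋯ + p_n = m`. -/
def katoSum (Hi : sys.Obs) (n m : ℕ) (F : sys.Obs) : sys.Obs :=
  ∑ p ∈ Finset.Nat.antidiagonalTuple (n + 1) m, sys.katoWord Hi n p F

/-- The perturbed averaging operator, the Kato series
`P_H = ∑ₙ (-1)^(n+1) α^n ∑_{p_0 + ⋯ + p_n = n} S^(p_n) L_{Hi} ⋯ L_{Hi} S^(p_0)`,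
acting on formal series in `α`. -/
def PH (Hi : sys.Obs) (F : sys.Series) : sys.Series :=
  PowerSeries.mk fun N => ∑ ij ∈ Finset.HasAntidiagonal.antidiagonal N,
    (-1 : ℝ) ^ (ij.1 + 1) • sys.katoSum Hi ij.1 ij.1 (PowerSeries.coeff ij.2 F)

/-- The perturbed integrating operator, the Kato series
`S_H = ∑ₙ (-1)^n α^n ∑_{p_0 + ⋯ + p_n = n + 1} S^(p_n) L_{Hi} ⋯ L_{Hi} S^(p_0)`,
acting on formal series in `α`. -/
def SH (Hi : sys.Obs) (F : sys.Series) : sys.Series :=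
  PowerSeries.mk fun N => ∑ ij ∈ Finset.HasAntidiagonal.antidiagonal N,
    (-1 : ℝ) ^ ij.1 • sys.katoSum Hi ij.1 (ij.1 + 1) (PowerSeries.coeff ij.2 F)

/-- The Poisson bracket of formal series in `α`. -/
def sbr (F G : sys.Series) : sys.Series :=
  PowerSeries.mk fun N => ∑ ij ∈ Finset.HasAntidiagonal.antidiagonal N,
    sys.br (PowerSeries.coeff ij.1 F) (PowerSeries.coeff ij.2 G)

/-- The Liouville operator `L_G F = [F, G]` on formal series in `α`. -/
def sL (G F : sys.Series) : sys.Series := sys.sbr F G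

/-- The perturbed Hamiltonian `H = H₀ + α Hi`. -/
def ham (Hi : sys.Obs) : sys.Series :=
  PowerSeries.C sys.h₀ + PowerSeries.X * PowerSeries.C Hi

/-- The coefficients of the Lie transform (Deprit exponent) with generator `G = ∑ α^n G_n`:
`U_0 = 1`, `U_n = (1/n) ∑_{k<n} L_{G_{n-k-1}} U_k`. -/
def depritU (G : sys.Series) : ℕ → sys.Obs → sys.Obs
  | 0, F => F
  | n + 1, F => ((n : ℝ) + 1)⁻¹ • ∑ k : Fin (n + 1),
      sys.L (PowerSeries.coeff (n - k) G) (depritU G k F)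

/-- The coefficients of the inverse Lie transform with generator `G = ∑ α^n G_n`:
`V_0 = 1`, `V_n = -(1/n) ∑_{k<n} V_k L_{G_{n-k-1}}`. -/
def depritV (G : sys.Series) : ℕ → sys.Obs → sys.Obs
  | 0, F => F
  | n + 1, F => -(((n : ℝ) + 1)⁻¹ • ∑ k : Fin (n + 1),
      depritV G k (sys.L (PowerSeries.coeff (n - k) G) F))

/-- The Lie transform with generator `G`, acting on formal series in `α`. -/
def lieU (G F : sys.Series) : sys.Series :=
  PowerSeries.mk fun N => ∑ ij ∈ Finset.HasAntidiagonal.antidiagonal N,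
    sys.depritU G ij.1 (PowerSeries.coeff ij.2 F)

/-- The inverse Lie transform with generator `G`, acting on formal series in `α`. -/
def lieV (G F : sys.Series) : sys.Series :=
  PowerSeries.mk fun N => ∑ ij ∈ Finset.HasAntidiagonal.antidiagonal N,
    sys.depritV G ij.1 (PowerSeries.coeff ij.2 F)

/-- The normalizing generator `G = -S_H Hi + P_H F` in the normalization style `F`. -/
def gen (Hi : sys.Obs) (F : sys.Series) : sys.Series :=
  -(sys.SH Hi (PowerSeries.C Hi)) + sys.PH Hi F

/-- The normalized Hamiltonian, in the normalization style `F`: the inverse Lie transform of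
`H₀ + α Hi`. -/
def normalizedHam (Hi : sys.Obs) (F : sys.Series) : sys.Series :=
  sys.lieV (sys.gen Hi F) (sys.ham Hi)

/-- The Gustavson integral with seed `I₀`, in the normalization style `F`: the Lie transform
of `I₀`. -/
def gustavson (Hi : sys.Obs) (F : sys.Series) (I₀ : sys.Obs) : sys.Series :=
  sys.lieU (sys.gen Hi F) (PowerSeries.C I₀)

end UnperturbedSystem

end KatoMech

end

/-! The operators `-P_H` and `S_H` are the coefficients of `z^(-1)` and `z^0` in the resolvent `(L_H
- z)⁻¹`, expanded as a Neumann series in `α` around the unperturbed resolvent `-P/z + S + S² z + ⋯`.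
Comparing coefficients in the resolvent equation gives `L_H S_H = 1 - P_H` and shows that `P_H`
commutes with `L_H`.

The heart of the proof is the intertwining relation `P_H U_G = U_G P` (`PH_lieU`). The derivative of
`H̃ = V_G H` in `α` is `V_G (Hi + [G, H])`, and the choice of `G` turns it into `V_G P_H (Hi + [F,
H])`. Since `V_G P_H U_G` is minus the residue of the resolvent of `L_H̃`, one can bootstrap in the
order of `α`. If `V_G P_H U_G` agrees with `P` below order `n`, then the coefficients of `H̃`
through order `n` are unperturbed integrals. By the Jacobi identity `P` then commutes with their
Liouville operators, and a purely algebraic uniqueness statement for the residue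
(`coeff_residue_eq`) gives the agreement at order `n` as well.

The claims follow because `U_G` is an automorphism of the bracket (`lieU_sbr`). The seed commutes
with `H̃` and with the image of `P`, so `I` commutes with `H` and with the image of `P_H`. In `∂I/∂α
= [I, G]` the style enters only through `[I, P_H F] = 0`, so `I` solves a linear equation free of
`F`, with a fixed initial value.

The analytic input is confined to Abel means along the flow: integration by parts and time shifts in
the Laplace transform give the identities linking `P`, `S` and `L_{H₀}`. -/

noncomputable section

namespace KatoMech

/-! ### The canonical Poisson bracket and the Jacobi identity. -/

section PoissonBracket

variable {d : ℕ} {U : TopologicalSpace.Opens (Phase d)}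

/-- The canonical Poisson bivector on covectors. -/
def poissonForm (ξ η : Phase d →L[ℝ] ℝ) : ℝ :=
  ∑ i, (ξ (Pi.single i 1, 0) * η (0, Pi.single i 1) - ξ (0, Pi.single i 1) * η (Pi.single i 1, 0))

/-- The Hamiltonian vector of a covector. -/
def hamVec (η : Phase d →L[ℝ] ℝ) : Phase d :=
  (fun i => η (0, Pi.single i 1), fun i => -η (Pi.single i 1, 0))

lemma clm_apply_eq_sum (ξ : Phase d →L[ℝ] ℝ) (v : Phase d) :
    ξ v = ∑ i, (v.1 i * ξ (Pi.single i 1, 0) + v.2 i * ξ (0, Pi.single i 1)) := by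
  have h : v = ∑ i, (v.1 i • ((Pi.single i 1, 0) : Phase d) +
      v.2 i • ((0, Pi.single i 1) : Phase d)) := by
    ext j <;> simp [Prod.fst_sum, Prod.snd_sum, Finset.sum_apply, Pi.single_apply]
  conv_lhs => rw [h]
  simp only [map_sum, map_add, map_smul, smul_eq_mul]

lemma poissonForm_eq_apply_hamVec (ξ η : Phase d →L[ℝ] ℝ) :
    poissonForm ξ η = ξ (hamVec η) := by
  rw [clm_apply_eq_sum]
  refine Finset.sum_congr rfl fun i _ => ?_
  simp only [hamVec]
  ring

lemma poissonForm_swap (ξ η : Phase d →L[ℝ] ℝ) : poissonForm ξ η = -poissonForm η ξ := by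
  simp only [poissonForm, ← Finset.sum_neg_distrib]
  exact Finset.sum_congr rfl fun i _ => by ring

lemma poissonForm_add_left (ξ ξ' η : Phase d →L[ℝ] ℝ) :
    poissonForm (ξ + ξ') η = poissonForm ξ η + poissonForm ξ' η := by
  simp [poissonForm_eq_apply_hamVec]

lemma poissonForm_smul_left (c : ℝ) (ξ η : Phase d →L[ℝ] ℝ) :
    poissonForm (c • ξ) η = c * poissonForm ξ η := by
  simp [poissonForm_eq_apply_hamVec]

lemma fderiv_poissonForm {f g : Phase d → ℝ} {x : Phase d} (hf : AnalyticAt ℝ f x)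
    (hg : AnalyticAt ℝ g x) (v : Phase d) :
    fderiv ℝ (fun y => poissonForm (fderiv ℝ f y) (fderiv ℝ g y)) x v =
      poissonForm (fderiv ℝ (fderiv ℝ f) x v) (fderiv ℝ g x) +
        poissonForm (fderiv ℝ f x) (fderiv ℝ (fderiv ℝ g) x v) := by
  have hf' := hf.fderiv.differentiableAt.hasFDerivAt
  have hg' := hg.fderiv.differentiableAt.hasFDerivAt
  have key := HasFDerivAt.fun_sum (u := Finset.univ) fun (i : Fin d) _ =>
    ((hf'.clm_apply (hasFDerivAt_const ((Pi.single i 1, 0) : Phase d) x)).mul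
      (hg'.clm_apply (hasFDerivAt_const ((0, Pi.single i 1) : Phase d) x))).sub
    ((hf'.clm_apply (hasFDerivAt_const ((0, Pi.single i 1) : Phase d) x)).mul
      (hg'.clm_apply (hasFDerivAt_const ((Pi.single i 1, 0) : Phase d) x)))
  have := congrArg (fun T : Phase d →L[ℝ] ℝ => T v) key.fderiv
  refine this.trans ?_
  simp only [poissonForm, ← Finset.sum_add_distrib]
  rw [sum_apply]
  refine Finset.sum_congr rfl fun i _ => ?_
  simp
  ring

lemma ext_apply (F : U → ℝ) (x : U) : ext F x = F x :=
  Subtype.val_injective.extend_apply F 0 x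

/-- The set is open, so the extension by zero does not affect germs, and hence derivatives, at its
points. -/
lemma ext_eventuallyEq {F : U → ℝ} {f : Phase d → ℝ} (h : ∀ y : U, F y = f y) (x : U) :
    ext F =ᶠ[𝓝 (x : Phase d)] f := by
  filter_upwards [U.isOpen.mem_nhds x.2] with y hy
  exact (ext_apply F ⟨y, hy⟩).trans (h ⟨y, hy⟩)

lemma poisson_apply (F G : U → ℝ) (x : U) :
    poisson F G x = poissonForm (fderiv ℝ (ext F) x) (fderiv ℝ (ext G) x) := rfl

lemma poisson_swap (F G : U → ℝ) : poisson F G = -poisson G F :=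
  funext fun _ => poissonForm_swap _ _

lemma poisson_add_left {F F' : U → ℝ} (hF : ∀ x : U, AnalyticAt ℝ (ext F) x)
    (hF' : ∀ x : U, AnalyticAt ℝ (ext F') x) (G : U → ℝ) :
    poisson (F + F') G = poisson F G + poisson F' G := by
  funext x
  have h : ext (F + F') =ᶠ[𝓝 (x : Phase d)] ext F + ext F' :=
    ext_eventuallyEq (fun y => by simp [ext_apply]) x
  simp only [Pi.add_apply, poisson_apply]
  rw [h.fderiv_eq, fderiv_add (hF x).differentiableAt (hF' x).differentiableAt,
    poissonForm_add_left]

lemma poisson_smul_left (c : ℝ) {F : U → ℝ} (hF : ∀ x : U, AnalyticAt ℝ (ext F) x) (G : U → ℝ) :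
    poisson (c • F) G = c • poisson F G := by
  funext x
  have h : ext (c • F) =ᶠ[𝓝 (x : Phase d)] c • ext F :=
    ext_eventuallyEq (fun y => by simp [ext_apply]) x
  simp only [Pi.smul_apply, poisson_apply]
  rw [h.fderiv_eq, fderiv_const_smul (hF x).differentiableAt, poissonForm_smul_left, smul_eq_mul]

lemma poisson_poisson_apply {F G : U → ℝ} (hF : ∀ x : U, AnalyticAt ℝ (ext F) x)
    (hG : ∀ x : U, AnalyticAt ℝ (ext G) x) (H : U → ℝ) (x : U) :
    poisson (poisson F G) H x =
      fderiv ℝ (fderiv ℝ (ext F)) x (hamVec (fderiv ℝ (ext H) x)) (hamVec (fderiv ℝ (ext G) x)) -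
      fderiv ℝ (fderiv ℝ (ext G)) x (hamVec (fderiv ℝ (ext H) x))
        (hamVec (fderiv ℝ (ext F) x)) := by
  have h : ext (poisson F G) =ᶠ[𝓝 (x : Phase d)]
      fun y => poissonForm (fderiv ℝ (ext F) y) (fderiv ℝ (ext G) y) :=
    ext_eventuallyEq (fun y => poisson_apply F G y) x
  rw [poisson_apply, h.fderiv_eq,
    poissonForm_eq_apply_hamVec, fderiv_poissonForm (hF x) (hG x),
    poissonForm_swap (fderiv ℝ (ext F) x)]
  simp only [poissonForm_eq_apply_hamVec]
  ring

/-- Each double bracket is a difference of two Hessians evaluated on Hamiltonian vectors; the six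
terms cancel in pairs by symmetry of second derivatives. -/
lemma poisson_jacobi {F G H : U → ℝ} (hF : ∀ x : U, AnalyticAt ℝ (ext F) x)
    (hG : ∀ x : U, AnalyticAt ℝ (ext G) x) (hH : ∀ x : U, AnalyticAt ℝ (ext H) x) :
    poisson (poisson F G) H + poisson (poisson G H) F + poisson (poisson H F) G = 0 := by
  have symm {f : Phase d → ℝ} {x : Phase d} (hf : AnalyticAt ℝ f x) (v w : Phase d) :
      fderiv ℝ (fderiv ℝ f) x v w = fderiv ℝ (fderiv ℝ f) x w v :=
    (hf.contDiffAt (n := 2)).isSymmSndFDerivAt (by simp) v w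
  funext x
  simp only [Pi.add_apply, Pi.zero_apply, poisson_poisson_apply hF hG, poisson_poisson_apply hG hH,
    poisson_poisson_apply hH hF]
  rw [symm (hF x) (hamVec (fderiv ℝ (ext H) x)), symm (hG x) (hamVec (fderiv ℝ (ext F) x)),
    symm (hH x) (hamVec (fderiv ℝ (ext F) x))]
  ring

end PoissonBracket

/-! ### Derivatives along the Hamiltonian flow. -/

section Flow

variable {d : ℕ} {U : TopologicalSpace.Opens (Phase d)} {H₀ : U → ℝ} {Φ : Flow ℝ U}

lemma IsHamiltonianFlow.hasDerivAt_comp (hΦ : IsHamiltonianFlow H₀ Φ) {F : U → ℝ}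
    (hF : ∀ x : U, AnalyticAt ℝ (ext F) x) (x : U) (t : ℝ) :
    HasDerivAt (fun s => F (Φ s x)) (poisson F H₀ (Φ t x)) t := by
  have hc : HasDerivAt (fun s => (Φ s x : Phase d)) (hamVec (fderiv ℝ (ext H₀) (Φ t x))) t :=
    (hasDerivAt_pi.2 fun i => hΦ.deriv_q x t i).prodMk (hasDerivAt_pi.2 fun i => hΦ.deriv_p x t i)
  have h := (hF (Φ t x)).differentiableAt.hasFDerivAt.comp_hasDerivAt t hc
  rw [poisson_apply, poissonForm_eq_apply_hamVec]
  refine h.congr_of_eventuallyEq (Eventually.of_forall fun s => ?_)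
  exact (ext_apply F (Φ s x)).symm

end Flow

namespace UnperturbedSystem

variable {d : ℕ} (sys : UnperturbedSystem d)

section Bracket

lemma br_swap (F G : sys.Obs) : sys.br F G = -sys.br G F :=
  Subtype.ext (poisson_swap F.1 G.1)

lemma br_add_left (F F' G : sys.Obs) : sys.br (F + F') G = sys.br F G + sys.br F' G :=
  Subtype.ext (poisson_add_left (sys.analytic F.1 F.2) (sys.analytic F'.1 F'.2) G.1)

lemma br_smul_left (c : ℝ) (F G : sys.Obs) : sys.br (c • F) G = c • sys.br F G :=
  Subtype.ext (poisson_smul_left c (sys.analytic F.1 F.2) G.1)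

lemma br_add_right (F G G' : sys.Obs) : sys.br F (G + G') = sys.br F G + sys.br F G' := by
  rw [br_swap, br_add_left, neg_add, ← br_swap, ← br_swap]

lemma br_smul_right (c : ℝ) (F G : sys.Obs) : sys.br F (c • G) = c • sys.br F G := by
  rw [br_swap, br_smul_left, ← smul_neg, ← br_swap]

lemma br_jacobi (F G H : sys.Obs) :
    sys.br (sys.br F G) H + sys.br (sys.br G H) F + sys.br (sys.br H F) G = 0 :=
  Subtype.ext (poisson_jacobi (sys.analytic F.1 F.2) (sys.analytic G.1 G.2) (sys.analytic H.1 H.2))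

/-- The Poisson bracket as a bilinear map. -/
def brₗ : sys.Obs →ₗ[ℝ] sys.Obs →ₗ[ℝ] sys.Obs :=
  LinearMap.mk₂ ℝ sys.br sys.br_add_left sys.br_smul_left sys.br_add_right sys.br_smul_right

@[simp] lemma brₗ_apply (F G : sys.Obs) : sys.brₗ F G = sys.br F G := rfl

@[simp] lemma br_zero_left (F : sys.Obs) : sys.br 0 F = 0 :=
  LinearMap.map_zero₂ sys.brₗ F

@[simp] lemma br_zero_right (F : sys.Obs) : sys.br F 0 = 0 := map_zero (sys.brₗ F)

/-- The bracket is a derivation of itself. -/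
lemma br_leibniz (F K G : sys.Obs) :
    sys.br (sys.br F K) G = sys.br (sys.br F G) K + sys.br F (sys.br K G) := by
  have h := sys.br_jacobi F K G
  rw [sys.br_swap (sys.br K G) F, sys.br_swap G F, ← sys.brₗ_apply (-sys.br F G), map_neg,
    LinearMap.neg_apply, brₗ_apply] at h
  linear_combination (exp := 1) h

end Bracket

/-! ### Abel means: identities between `P`, `S` and `L_{H₀}`. -/

section Averages

lemma hasDerivAt_orbit (F : sys.Obs) (x : sys.domain) (t : ℝ) :
    HasDerivAt (fun s => F.1 (sys.flow s x)) ((sys.L sys.h₀ F).1 (sys.flow t x)) t :=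
  sys.isHamiltonianFlow.hasDerivAt_comp (sys.analytic F.1 F.2) x t

lemma continuous_orbit (F : sys.Obs) (x : sys.domain) :
    Continuous fun s => F.1 (sys.flow s x) :=
  continuous_iff_continuousAt.2 fun t => (sys.hasDerivAt_orbit F x t).continuousAt

lemma continuous_exp_orbit (F : sys.Obs) (x : sys.domain) :
    Continuous (Function.uncurry fun lam t => Real.exp (-lam * t) * F.1 (sys.flow t x)) := by
  have h : Continuous fun a : ℝ × ℝ => Real.exp (-a.1 * a.2) := by fun_prop
  exact h.mul ((sys.continuous_orbit F x).comp continuous_snd)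

lemma tendsto_P (F : sys.Obs) (x : sys.domain) :
    Tendsto (fun lam => lam * laplace sys.flow F.1 x lam) (𝓝[>] 0) (𝓝 ((sys.P F).1 x)) := by
  obtain ⟨l, hl⟩ := sys.exists_avg F.1 F.2 x
  have : (sys.P F).1 x = l := hl.limUnder_eq
  rwa [this]

lemma tendsto_S (F : sys.Obs) (x : sys.domain) :
    Tendsto (fun lam => laplace sys.flow (F - sys.P F).1 x lam) (𝓝[>] 0)
      (𝓝 (-(sys.S F).1 x)) := by
  obtain ⟨l, hl⟩ := sys.exists_int F.1 F.2 x
  have : (sys.S F).1 x = -l := congrArg Neg.neg hl.limUnder_eq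
  rw [this, neg_neg]
  exact hl

lemma laplace_add (F G : sys.Obs) (x : sys.domain) {lam : ℝ} (h : 0 < lam) :
    laplace sys.flow (F + G).1 x lam =
      laplace sys.flow F.1 x lam + laplace sys.flow G.1 x lam := by
  unfold laplace
  rw [← integral_add (sys.integrable F.1 F.2 x lam h) (sys.integrable G.1 G.2 x lam h)]
  exact integral_congr_ae (Eventually.of_forall fun t => mul_add _ _ _)

lemma laplace_smul (c : ℝ) (F : sys.Obs) (x : sys.domain) (lam : ℝ) :
    laplace sys.flow (c • F).1 x lam = c * laplace sys.flow F.1 x lam := by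
  unfold laplace
  rw [← integral_const_mul]
  exact integral_congr_ae (Eventually.of_forall fun t => mul_left_comm _ _ _)

lemma P_add (F G : sys.Obs) : sys.P (F + G) = sys.P F + sys.P G := by
  refine Subtype.ext (funext fun x => tendsto_nhds_unique (sys.tendsto_P (F + G) x) ?_)
  refine ((sys.tendsto_P F x).add (sys.tendsto_P G x)).congr' ?_
  filter_upwards [self_mem_nhdsWithin] with lam h
  rw [sys.laplace_add F G x h, mul_add]

lemma P_smul (c : ℝ) (F : sys.Obs) : sys.P (c • F) = c • sys.P F := by
  refine Subtype.ext (funext fun x => tendsto_nhds_unique (sys.tendsto_P (c • F) x) ?_)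
  refine ((sys.tendsto_P F x).const_mul c).congr fun lam => ?_
  rw [sys.laplace_smul, mul_left_comm]

lemma S_add (F G : sys.Obs) : sys.S (F + G) = sys.S F + sys.S G := by
  refine Subtype.ext (funext fun x => neg_injective
    (tendsto_nhds_unique (sys.tendsto_S (F + G) x) ?_))
  have h := (sys.tendsto_S F x).add (sys.tendsto_S G x)
  rw [← neg_add] at h
  refine h.congr' ?_
  filter_upwards [self_mem_nhdsWithin] with lam h
  rw [← sys.laplace_add _ _ x h, P_add, add_sub_add_comm]

lemma S_smul (c : ℝ) (F : sys.Obs) : sys.S (c • F) = c • sys.S F := by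
  refine Subtype.ext (funext fun x => neg_injective
    (tendsto_nhds_unique (sys.tendsto_S (c • F) x) ?_))
  have h := (sys.tendsto_S F x).const_mul c
  rw [mul_neg] at h
  refine h.congr fun lam => ?_
  rw [← sys.laplace_smul, P_smul, smul_sub]

/-- The averaging operator as a linear map. -/
def Pₗ : Module.End ℝ sys.Obs := ⟨⟨sys.P, sys.P_add⟩, sys.P_smul⟩

/-- The integrating operator as a linear map. -/
def Sₗ : Module.End ℝ sys.Obs := ⟨⟨sys.S, sys.S_add⟩, sys.S_smul⟩

@[simp] lemma Sₗ_apply (F : sys.Obs) : sys.Sₗ F = sys.S F := rfl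

/-- Integration by parts: `L_{H₀} F` is the time derivative of `F` along the orbit. -/
lemma laplace_L_h₀ (F : sys.Obs) (x : sys.domain) {lam : ℝ} (h : 0 < lam) :
    laplace sys.flow (sys.L sys.h₀ F).1 x lam = lam * laplace sys.flow F.1 x lam - F.1 x := by
  have hi := sys.integrable F.1 F.2 x lam h
  have hi' := sys.integrable _ (sys.L sys.h₀ F).2 x lam h
  have hd (t : ℝ) : HasDerivAt (fun t => Real.exp (-lam * t) * F.1 (sys.flow t x))
      (Real.exp (-lam * t) * (sys.L sys.h₀ F).1 (sys.flow t x) -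
        lam * (Real.exp (-lam * t) * F.1 (sys.flow t x))) t := by
    have he : HasDerivAt (fun t : ℝ => Real.exp (-lam * t)) (Real.exp (-lam * t) * -lam) t := by
      simpa using ((hasDerivAt_id t).const_mul (-lam)).exp
    refine (he.mul (sys.hasDerivAt_orbit F x t)).congr_deriv ?_
    ring
  have hi'' := hi'.sub (hi.const_mul lam)
  -- The boundary term at infinity vanishes because the function and its derivative are both
  -- integrable; no growth bound on `F` is needed.
  have h0 := tendsto_zero_of_hasDerivAt_of_integrableOn_Ioi (fun t _ => hd t) hi'' hi
  have := integral_Ioi_of_hasDerivAt_of_tendsto' (fun t _ => hd t) hi'' h0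
  rw [integral_sub hi' (hi.const_mul lam), integral_const_mul] at this
  simp only [mul_zero, Real.exp_zero, sys.flow.map_zero_apply, one_mul] at this
  unfold laplace
  linarith

lemma P_L_h₀ (F : sys.Obs) : sys.P (sys.L sys.h₀ F) = 0 := by
  refine Subtype.ext (funext fun x => tendsto_nhds_unique (sys.tendsto_P (sys.L sys.h₀ F) x) ?_)
  have hl : Tendsto (fun lam : ℝ => lam) (𝓝[>] 0) (𝓝 0) := tendsto_nhdsWithin_of_tendsto_nhds
    tendsto_id
  have h := hl.mul ((sys.tendsto_P F x).sub_const (F.1 x))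
  rw [zero_mul] at h
  refine h.congr' ?_
  filter_upwards [self_mem_nhdsWithin] with lam h
  rw [sys.laplace_L_h₀ F x h]

lemma S_L_h₀ (F : sys.Obs) : sys.S (sys.L sys.h₀ F) = F - sys.P F := by
  refine Subtype.ext (funext fun x => neg_injective
    (tendsto_nhds_unique (sys.tendsto_S (sys.L sys.h₀ F) x) ?_))
  have h := (sys.tendsto_P F x).sub_const (F.1 x)
  have e : (sys.P F).1 x - F.1 x = -(F - sys.P F).1 x := (neg_sub _ _).symm
  rw [e] at h
  refine h.congr' ?_
  filter_upwards [self_mem_nhdsWithin] with lam h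
  rw [P_L_h₀, sub_zero, sys.laplace_L_h₀ F x h]

/-- Substituting `t + s` for the time moves the base point back to `x`, at the cost of a factor and
an integral over a bounded interval. As `lam → +0` that integral has a finite limit: it disappears
from `P` and survives in `S`. -/
lemma laplace_flow (F : sys.Obs) (x : sys.domain) (s : ℝ) {lam : ℝ} (h : 0 < lam) :
    laplace sys.flow F.1 (sys.flow s x) lam = Real.exp (lam * s) * (laplace sys.flow F.1 x lam -
      ∫ t in (0 : ℝ)..s, Real.exp (-lam * t) * F.1 (sys.flow t x)) := by
  set g : ℝ → ℝ := fun t => Real.exp (-lam * t) * F.1 (sys.flow t x) with hg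
  have hc : Continuous g := (sys.continuous_exp_orbit F x).comp (Continuous.prodMk_right lam)
  have h1 : ∫ t in Set.Ioi (0 : ℝ), g (t + s) = ∫ t in Set.Ioi s, g t := by
    have := (measurePreserving_add_right volume s).setIntegral_preimage_emb
      (measurableEmbedding_addRight s) g (Set.Ioi s)
    simpa using this
  have h2 := intervalIntegral.integral_interval_add_Ioi' (hc.intervalIntegrable s 0)
    (sys.integrable F.1 F.2 x lam h)
  rw [intervalIntegral.integral_symm] at h2
  have h3 : laplace sys.flow F.1 (sys.flow s x) lam =
      Real.exp (lam * s) * ∫ t in Set.Ioi (0 : ℝ), g (t + s) := by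
    unfold laplace
    rw [← integral_const_mul]
    refine integral_congr_ae (Eventually.of_forall fun t => ?_)
    simp only [hg, sys.flow.map_add]
    rw [← mul_assoc, ← Real.exp_add]
    congr 2
    ring
  rw [h3, h1, ← h2]
  unfold laplace
  ring

lemma tendsto_exp_integral_orbit (F : sys.Obs) (x : sys.domain) (s : ℝ) :
    Tendsto (fun lam => ∫ t in (0 : ℝ)..s, Real.exp (-lam * t) * F.1 (sys.flow t x)) (𝓝[>] 0)
      (𝓝 (∫ t in (0 : ℝ)..s, F.1 (sys.flow t x))) := by
  have hc : Continuous fun lam : ℝ =>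
      ∫ t in (0 : ℝ)..s, Real.exp (-lam * t) * F.1 (sys.flow t x) :=
    intervalIntegral.continuous_parametric_intervalIntegral_of_continuous'
      (sys.continuous_exp_orbit F x) 0 s
  have := (hc.tendsto 0).mono_left (nhdsWithin_le_nhds (s := Set.Ioi 0))
  simpa using this

lemma tendsto_exp_mul_const (s : ℝ) :
    Tendsto (fun lam : ℝ => Real.exp (lam * s)) (𝓝[>] 0) (𝓝 1) := by
  have hc : Continuous fun lam : ℝ => Real.exp (lam * s) := by fun_prop
  simpa using (hc.tendsto 0).mono_left (nhdsWithin_le_nhds (s := Set.Ioi 0))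

lemma P_flow (F : sys.Obs) (x : sys.domain) (s : ℝ) :
    (sys.P F).1 (sys.flow s x) = (sys.P F).1 x := by
  refine tendsto_nhds_unique (sys.tendsto_P F (sys.flow s x)) ?_
  have hl : Tendsto (fun lam : ℝ => lam) (𝓝[>] 0) (𝓝 0) := tendsto_nhdsWithin_of_tendsto_nhds
    tendsto_id
  have h := (tendsto_exp_mul_const s).mul
    ((sys.tendsto_P F x).sub (hl.mul (sys.tendsto_exp_integral_orbit F x s)))
  rw [zero_mul, sub_zero, one_mul] at h
  refine h.congr' ?_
  filter_upwards [self_mem_nhdsWithin] with lam h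
  rw [sys.laplace_flow F x s h]
  ring

lemma S_flow (F : sys.Obs) (x : sys.domain) (s : ℝ) :
    (sys.S F).1 (sys.flow s x) =
      (sys.S F).1 x + ∫ t in (0 : ℝ)..s, (F - sys.P F).1 (sys.flow t x) := by
  refine neg_injective (tendsto_nhds_unique (sys.tendsto_S F (sys.flow s x)) ?_)
  have h := (tendsto_exp_mul_const s).mul
    ((sys.tendsto_S F x).sub (sys.tendsto_exp_integral_orbit (F - sys.P F) x s))
  rw [one_mul, ← neg_add'] at h
  refine h.congr' ?_
  filter_upwards [self_mem_nhdsWithin] with lam h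
  rw [sys.laplace_flow _ x s h]

lemma L_h₀_P (F : sys.Obs) : sys.L sys.h₀ (sys.P F) = 0 := by
  refine Subtype.ext (funext fun x => ?_)
  have h := sys.hasDerivAt_orbit (sys.P F) x 0
  simp only [sys.P_flow, sys.flow.map_zero_apply] at h
  exact h.unique (hasDerivAt_const _ _)

/-- By `S_flow`, `S F` along an orbit is an antiderivative of `F - P F`; differentiate at time zero.
-/
lemma L_h₀_S (F : sys.Obs) : sys.L sys.h₀ (sys.S F) = F - sys.P F := by
  refine Subtype.ext (funext fun x => ?_)
  have h := sys.hasDerivAt_orbit (sys.S F) x 0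
  simp only [sys.S_flow, sys.flow.map_zero_apply] at h
  refine h.unique ?_
  have hc := sys.continuous_orbit (F - sys.P F) x
  have := (intervalIntegral.integral_hasDerivAt_right (hc.intervalIntegrable 0 0)
    (hc.stronglyMeasurableAtFilter _ _) hc.continuousAt).const_add ((sys.S F).1 x)
  simpa [sys.flow.map_zero_apply] using this

lemma P_eq_self_iff {F : sys.Obs} : sys.P F = F ↔ sys.IsIntegral F := by
  constructor
  · intro h
    rw [← h]
    exact sys.L_h₀_P F
  · intro h
    have := sys.S_L_h₀ F
    rw [show sys.L sys.h₀ F = 0 from h] at this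
    exact (sub_eq_zero.1 (this.symm.trans (map_zero sys.Sₗ))).symm

lemma isIntegral_P (F : sys.Obs) : sys.IsIntegral (sys.P F) := sys.L_h₀_P F

lemma P_P (F : sys.Obs) : sys.P (sys.P F) = sys.P F := sys.P_eq_self_iff.2 (sys.isIntegral_P F)

lemma S_P (F : sys.Obs) : sys.S (sys.P F) = 0 := by
  refine Subtype.ext (funext fun x => neg_injective
    (tendsto_nhds_unique (sys.tendsto_S (sys.P F) x) ?_))
  rw [P_P, sub_self]
  simp [laplace]

lemma P_S (F : sys.Obs) : sys.P (sys.S F) = 0 := by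
  -- Evaluate `S L_{H₀} S F` in two ways, by `S L_{H₀} = 1 - P` and by `L_{H₀} S = 1 - P`, using `S
  -- P = 0`.
  have h := sys.S_L_h₀ (sys.S F)
  rw [L_h₀_S, ← Sₗ_apply, map_sub, Sₗ_apply, Sₗ_apply, S_P, sub_zero] at h
  exact (sub_eq_self.1 h.symm)

/-- The average commutes with the Liouville operators of integrals. -/
lemma P_br_of_isIntegral {J : sys.Obs} (hJ : sys.IsIntegral J) (F : sys.Obs) :
    sys.P (sys.br F J) = sys.br (sys.P F) J := by
  have comm (G : sys.Obs) : sys.br (sys.L sys.h₀ G) J = sys.L sys.h₀ (sys.br G J) := by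
    have h := sys.br_leibniz G J sys.h₀
    rw [show sys.br J sys.h₀ = 0 from hJ, br_zero_right, add_zero] at h
    exact h.symm
  -- The first summand stays in the image of `L_{H₀}` after bracketing with `J`, so `P` kills it;
  -- the second stays an integral, so `P` fixes it.
  have hF : F = sys.L sys.h₀ (sys.S F) + sys.P F := by rw [L_h₀_S, sub_add_cancel]
  have hint : sys.IsIntegral (sys.br (sys.P F) J) := by
    have h := comm (sys.P F)
    rw [L_h₀_P, br_zero_left] at h
    exact h.symm
  conv_lhs => rw [hF, br_add_left, P_add, comm, P_L_h₀, zero_add, sys.P_eq_self_iff.2 hint]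

end Averages

end UnperturbedSystem

/-! ### Formal Laurent coefficients of a resolvent and uniqueness of its residue. -/

section FormalResolvent

open PowerSeries

variable {Ω : Type*} [Ring Ω]

lemma X_pow_dvd_mul_left {n : ℕ} {a : PowerSeries Ω} (h : (X : PowerSeries Ω) ^ n ∣ a)
    (b : PowerSeries Ω) : X ^ n ∣ b * a := by
  obtain ⟨c, rfl⟩ := h
  exact ⟨b * c, by rw [← mul_assoc, (commute_X_pow b n).eq, mul_assoc]⟩

/-- The residue of the resolvent of a formal perturbation `M` of `d` that commutes, up to order
`n`, with the spectral projection `p` of `d` agrees up to order `n` with `-p`. The family `T`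
consists of the Laurent coefficients of the resolvent. -/
theorem coeff_residue_eq {d p s : Ω} (hdp : d * p = 0) (hds : d * s = 1 - p) (hps : p * s = 0)
    (hpp : p * p = p) {M : PowerSeries Ω} {T : ℤ → PowerSeries Ω} {n : ℕ}
    (hM : coeff 0 M = d) (hMp : ∀ k ≤ n, p * coeff k M = coeff k M * p)
    (hT : ∀ m, T m * M = T (m - 1) + if m = 0 then 1 else 0)
    (hT0 : ∀ (k : ℕ) (m : ℤ), m < -(k + 1) → coeff k (T m) = 0) :
    ∀ k ≤ n, coeff k (T (-1)) = coeff k (-C p) := by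
  -- Truncation gives a series that commutes with `p` at every order and still satisfies the
  -- recursion modulo `X ^ (n + 1)`.
  set N : PowerSeries Ω := mk fun k => if k ≤ n then coeff k M else 0 with hNdef
  have hN0 : coeff 0 N = d := by simp [hNdef, hM]
  have hNp : C p * N = N * C p := by
    ext k
    rw [coeff_C_mul, coeff_mul_C, hNdef, coeff_mk]
    split_ifs with h
    · exact hMp k h
    · simp
  have hTN (m : ℤ) : X ^ (n + 1) ∣ T m * N - (T (m - 1) + if m = 0 then 1 else 0) := by
    rw [← hT, ← mul_sub]
    refine X_pow_dvd_mul_left (X_pow_dvd_iff.2 fun k hk => ?_) _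
    rw [map_sub, hNdef, coeff_mk, if_pos (Nat.lt_succ_iff.1 hk), sub_self]
  have hCpp : C p * C p = C p := by rw [← map_mul, hpp]
  have hCps : C p * C s = 0 := by rw [← map_mul, hps, map_zero]
  -- `w` has constant term `d s + p = 1`, so it is invertible, and `Y = s w⁻¹` is a right inverse of
  -- `N` on the range of `1 - p`.
  set w := N * C s + C p with hw
  have hw0 : constantCoeff w = ((1 : Ωˣ) : Ω) := by
    rw [← coeff_zero_eq_constantCoeff_apply, hw, map_add, coeff_mul_C, hN0, hds, coeff_zero_C]
    simp
  set Y := C s * invOfUnit w 1 with hY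
  have hpY : (1 - C p) * Y = Y := by
    rw [hY, ← mul_assoc, sub_mul, hCps, one_mul, sub_zero]
  have hNY : N * Y = 1 - C p := by
    have h1 : (1 - C p) * w = N * C s := by
      rw [hw, mul_add, sub_mul, sub_mul, ← mul_assoc (C p), hNp, mul_assoc N, hCps, hCpp]
      simp
    rw [hY, ← mul_assoc, ← h1, mul_assoc, mul_invOfUnit w 1 hw0, mul_one]
  -- Running the recursion down to negative indices reaches coefficients that vanish by the bound on
  -- the pole order, so the residue kills `1 - p`.
  have chainY (k : ℕ) : X ^ (n + 1) ∣
      T (-1 - k) * ((1 - C p) * Y ^ k) - T (-1) * (1 - C p) := by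
    induction k with
    | zero => simp
    | succ k ih =>
      have h := (hTN (-1 - k)).mul_right (Y ^ (k + 1))
      have e : (-1 - (k : ℤ)) ≠ 0 := by omega
      rw [if_neg e, add_zero, sub_mul, pow_succ' Y k, mul_assoc (T _), ← mul_assoc N, hNY] at h
      have h2 := dvd_sub ih h
      rw [pow_succ' Y, ← mul_assoc (1 - C p), hpY]
      have e2 : -1 - ((k + 1 : ℕ) : ℤ) = -1 - (k : ℤ) - 1 := by push_cast; ring
      rw [e2]
      convert h2 using 1
      abel
  have regular : X ^ (n + 1) ∣ T (-1) * (1 - C p) := by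
    have h1 : X ^ (n + 1) ∣ T (-1 - ((n + 1 : ℕ) : ℤ)) * ((1 - C p) * Y ^ (n + 1)) := by
      refine (X_pow_dvd_iff.2 fun k hk => hT0 k _ ?_).mul_right _
      push_cast
      omega
    exact (dvd_sub_right h1).1 (chainY (n + 1))
  -- Running it upwards collects powers of `N` in front of `p`. Since `d p = 0`, each contributes a
  -- factor `X`, so `T 0 * N * p` vanishes modulo `X ^ (n + 1)`.
  have chainN (k : ℕ) : X ^ (n + 1) ∣ T k * (N ^ (k + 1) * C p) - T 0 * (N * C p) := by
    induction k with
    | zero => simp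
    | succ k ih =>
      have h := (hTN ((k + 1 : ℕ) : ℤ)).mul_right (N ^ (k + 1) * C p)
      have e : ((k + 1 : ℕ) : ℤ) ≠ 0 := by omega
      have e2 : ((k + 1 : ℕ) : ℤ) - 1 = k := by push_cast; ring
      rw [if_neg e, add_zero, e2, sub_mul, mul_assoc, ← mul_assoc N, ← pow_succ'] at h
      have h2 := dvd_add h ih
      rwa [sub_add_sub_cancel] at h2
  have hXN (k : ℕ) : X ^ k ∣ N ^ k * C p := by
    obtain ⟨W, hW⟩ : X ∣ N * C p := by
      rw [X_dvd_iff, ← coeff_zero_eq_constantCoeff_apply, coeff_mul_C, hN0, hdp]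
    induction k with
    | zero => simp
    | succ k ih =>
      obtain ⟨W', hW'⟩ := ih
      refine ⟨W' * W, ?_⟩
      have e : N * C p = C p * (N * C p) := by rw [← mul_assoc, hNp, mul_assoc, hCpp]
      rw [pow_succ, mul_assoc, e, ← mul_assoc, hW', hW, pow_succ, mul_assoc, mul_assoc,
        ← mul_assoc W', (commute_X W').eq, mul_assoc]
  have singular : X ^ (n + 1) ∣ T 0 * (N * C p) :=
    (dvd_sub_right (X_pow_dvd_mul_left (hXN (n + 1)) (T n))).1 (chainN n)
  -- The recursion at index `0`, where the unit enters, now gives `T (-1) * p ≡ -p`.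
  have h0 := (hTN 0).mul_right (C p)
  rw [if_pos rfl, sub_mul, add_mul, mul_assoc, one_mul, dvd_sub_right singular] at h0
  have h1 : X ^ (n + 1) ∣ T (-1) - -C p := by
    convert dvd_add h0 regular using 1
    rw [mul_sub, mul_one, zero_sub]
    abel
  intro k hk
  exact sub_eq_zero.1 (by rw [← map_sub]; exact X_pow_dvd_iff.1 h1 k (Nat.lt_succ_iff.2 hk))

/-- The coefficient of a power series at an integer. -/
def zcoeff (f : PowerSeries Ω) (s : ℤ) : Ω := if 0 ≤ s then coeff s.toNat f else 0

@[simp] lemma zcoeff_natCast (f : PowerSeries Ω) (s : ℕ) : zcoeff f s = coeff s f := by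
  simp [zcoeff]

lemma zcoeff_of_neg (f : PowerSeries Ω) {s : ℤ} (h : s < 0) : zcoeff f s = 0 :=
  if_neg (not_le.2 h)

lemma zcoeff_add (f g : PowerSeries Ω) (s : ℤ) : zcoeff (f + g) s = zcoeff f s + zcoeff g s := by
  unfold zcoeff
  split_ifs <;> simp

lemma zcoeff_mul_C (f : PowerSeries Ω) (a : Ω) (s : ℤ) :
    zcoeff (f * C a) s = zcoeff f s * a := by
  unfold zcoeff
  split_ifs <;> simp

lemma zcoeff_C_mul (f : PowerSeries Ω) (a : Ω) (s : ℤ) :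
    zcoeff (C a * f) s = a * zcoeff f s := by
  unfold zcoeff
  split_ifs <;> simp

lemma zcoeff_one (s : ℤ) : zcoeff (1 : PowerSeries Ω) s = if s = 0 then 1 else 0 := by
  rcases lt_or_ge s 0 with h | h
  · rw [zcoeff_of_neg _ h, if_neg h.ne]
  · lift s to ℕ using h
    simp [coeff_one]

lemma zcoeff_X_mul (f : PowerSeries Ω) (s : ℤ) : zcoeff (X * f) s = zcoeff f (s - 1) := by
  rcases lt_or_ge s 0 with h | h
  · rw [zcoeff_of_neg _ h, zcoeff_of_neg _ (by omega)]
  · lift s to ℕ using h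
    cases s with
    | zero => rw [zcoeff_natCast, zcoeff_of_neg _ (by simp)]; simp
    | succ k =>
      have e : ((k + 1 : ℕ) : ℤ) - 1 = k := by push_cast; ring
      rw [e, zcoeff_natCast, zcoeff_natCast, coeff_succ_X_mul]

/-- The regularized unperturbed resolvent `z ↦ -p + s z + s² z² + ⋯`. -/
def resolventSeries (p s : Ω) : PowerSeries Ω := mk fun k => if k = 0 then -p else s ^ k

lemma resolventSeries_mul_C {d p s : Ω} (hpd : p * d = 0) (hsd : s * d = 1 - p)
    (hsp : s * p = 0) :
    resolventSeries p s * C d = X * (resolventSeries p s + 1) := by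
  ext k
  rw [coeff_mul_C, resolventSeries, coeff_mk]
  rcases k with _ | _ | k
  · simp [hpd]
  · rw [coeff_succ_X_mul]
    simp [hsd, sub_eq_neg_add]
  · rw [coeff_succ_X_mul]
    simp [coeff_one, pow_succ s (k + 1), mul_assoc, hsd, mul_sub, hsp, pow_succ s k]

lemma C_mul_resolventSeries {d p s : Ω} (hdp : d * p = 0) (hds : d * s = 1 - p)
    (hps : p * s = 0) :
    C d * resolventSeries p s = X * (resolventSeries p s + 1) := by
  ext k
  rw [coeff_C_mul, resolventSeries, coeff_mk]
  rcases k with _ | _ | k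
  · simp [hdp]
  · rw [coeff_succ_X_mul]
    simp [hds, sub_eq_neg_add]
  · rw [coeff_succ_X_mul]
    simp [coeff_one, pow_succ' s (k + 1), ← mul_assoc, hds, sub_mul, hps, pow_succ' s k]

/-- The generating function of the Kato products with `n` factors `b`. -/
def katoSeries (p s b : Ω) (n : ℕ) : PowerSeries Ω :=
  resolventSeries p s * (C b * resolventSeries p s) ^ n

lemma katoSeries_succ (p s b : Ω) (n : ℕ) :
    katoSeries p s b (n + 1) = katoSeries p s b n * (C b * resolventSeries p s) := by
  rw [katoSeries, katoSeries, pow_succ, mul_assoc]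

lemma katoSeries_succ' (p s b : Ω) (n : ℕ) :
    katoSeries p s b (n + 1) = resolventSeries p s * C b * katoSeries p s b n := by
  rw [katoSeries, katoSeries, pow_succ']
  simp only [mul_assoc]

/-- The Laurent coefficients of the resolvent of `d + α b`, as formal series in `α`. -/
def katoRes (p s b : Ω) (m : ℤ) : PowerSeries Ω :=
  mk fun i => (-1) ^ i * zcoeff (katoSeries p s b i) (m + i + 1)

lemma coeff_katoRes (p s b : Ω) (m : ℤ) (i : ℕ) :
    coeff i (katoRes p s b m) = (-1) ^ i * zcoeff (katoSeries p s b i) (m + i + 1) :=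
  coeff_mk _ _

lemma coeff_katoRes_of_even (p s b : Ω) (m : ℤ) {i : ℕ} (h : Even i) :
    coeff i (katoRes p s b m) = zcoeff (katoSeries p s b i) (m + i + 1) := by
  rw [coeff_katoRes, h.neg_one_pow, one_mul]

lemma coeff_katoRes_of_odd (p s b : Ω) (m : ℤ) {i : ℕ} (h : Odd i) :
    coeff i (katoRes p s b m) = -zcoeff (katoSeries p s b i) (m + i + 1) := by
  rw [coeff_katoRes, h.neg_one_pow, neg_one_mul]

/-- A Neumann term of order `k` contains `k + 1` unperturbed resolvents, each with a simple pole. -/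
lemma coeff_katoRes_eq_zero (p s b : Ω) (k : ℕ) (m : ℤ) (h : m < -(k + 1)) :
    coeff k (katoRes p s b m) = 0 := by
  rw [coeff_katoRes, zcoeff_of_neg _ (by omega), mul_zero]

/-- The resolvent equation on one side: the `d` part of order `n + 1` and the `b` part of order `n`
telescope. As `Ω` is noncommutative, the other side needs its own argument, `mul_katoRes`. -/
lemma katoRes_mul {d p s : Ω} (hpd : p * d = 0) (hsd : s * d = 1 - p) (hsp : s * p = 0)
    (b : Ω) (m : ℤ) :
    katoRes p s b m * (C d + X * C b) = katoRes p s b (m - 1) + if m = 0 then 1 else 0 := by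
  have hR := resolventSeries_mul_C hpd hsd hsp
  ext n
  rw [mul_add, ← mul_assoc, (commute_X (katoRes p s b m)).eq, mul_assoc, map_add, map_add,
    coeff_mul_C]
  cases n with
  | zero =>
    have h := zcoeff_mul_C (katoSeries p s b 0) d (m + 1)
    rw [katoSeries, pow_zero, mul_one, hR, zcoeff_X_mul, zcoeff_add, zcoeff_one] at h
    simp only [coeff_katoRes, katoSeries, pow_zero, one_mul, mul_one, coeff_zero_X_mul, add_zero,
      Nat.cast_zero]
    rw [← h]
    split_ifs <;> simp_all
  | succ n =>
    have h := zcoeff_mul_C (katoSeries p s b (n + 1)) d (m + (n + 1 : ℕ) + 1)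
    have e : katoSeries p s b (n + 1) * C d =
        X * (katoSeries p s b (n + 1) + katoSeries p s b n * C b) := by
      rw [katoSeries_succ, mul_assoc, mul_assoc, hR, ← mul_assoc (C b), (commute_X (C b)).eq]
      simp only [← mul_assoc]
      rw [(commute_X _).eq]
      simp only [mul_add, mul_one, mul_assoc]
    rw [e, zcoeff_X_mul, zcoeff_add, zcoeff_mul_C] at h
    have e1 : m + ((n + 1 : ℕ) : ℤ) + 1 - 1 = m - 1 + (n + 1 : ℕ) + 1 := by ring
    have e2 : m - 1 + ((n + 1 : ℕ) : ℤ) + 1 = m + n + 1 := by push_cast; ring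
    rw [coeff_succ_X_mul, coeff_mul_C, coeff_katoRes, coeff_katoRes, coeff_katoRes, mul_assoc, ← h,
      e1, e2]
    have e3 : coeff (n + 1) (if m = 0 then (1 : PowerSeries Ω) else 0) = 0 := by
      split_ifs <;> simp [coeff_one]
    rw [e3, add_zero, mul_add, pow_succ]
    simp only [mul_neg, mul_one, neg_mul, mul_assoc]
    abel

lemma mul_katoRes {d p s : Ω} (hdp : d * p = 0) (hds : d * s = 1 - p) (hps : p * s = 0)
    (b : Ω) (m : ℤ) :
    (C d + X * C b) * katoRes p s b m = katoRes p s b (m - 1) + if m = 0 then 1 else 0 := by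
  have hR := C_mul_resolventSeries hdp hds hps
  ext n
  rw [add_mul, mul_assoc, map_add, map_add, coeff_C_mul]
  cases n with
  | zero =>
    have h := zcoeff_C_mul (katoSeries p s b 0) d (m + 1)
    rw [katoSeries, pow_zero, mul_one, hR, zcoeff_X_mul, zcoeff_add, zcoeff_one] at h
    simp only [coeff_katoRes, katoSeries, pow_zero, one_mul, mul_one, coeff_zero_X_mul, add_zero,
      Nat.cast_zero]
    rw [← h]
    split_ifs <;> simp_all
  | succ n =>
    have h := zcoeff_C_mul (katoSeries p s b (n + 1)) d (m + (n + 1 : ℕ) + 1)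
    have e : C d * katoSeries p s b (n + 1) =
        X * (katoSeries p s b (n + 1) + C b * katoSeries p s b n) := by
      rw [katoSeries_succ', ← mul_assoc, ← mul_assoc, hR]
      simp only [mul_add, add_mul, one_mul, mul_assoc]
    rw [e, zcoeff_X_mul, zcoeff_add, zcoeff_C_mul] at h
    have e1 : m + ((n + 1 : ℕ) : ℤ) + 1 - 1 = m - 1 + (n + 1 : ℕ) + 1 := by ring
    have e2 : m - 1 + ((n + 1 : ℕ) : ℤ) + 1 = m + n + 1 := by push_cast; ring
    have hc (a c : Ω) (k : ℕ) : a * ((-1) ^ k * c) = (-1) ^ k * (a * c) := by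
      rw [← mul_assoc, ← mul_assoc, ((Commute.neg_one_right a).pow_right k).eq]
    rw [coeff_succ_X_mul, coeff_C_mul, coeff_katoRes, coeff_katoRes, coeff_katoRes, hc, hc, ← h,
      e1, e2]
    have e3 : coeff (n + 1) (if m = 0 then (1 : PowerSeries Ω) else 0) = 0 := by
      split_ifs <;> simp [coeff_one]
    rw [e3, add_zero, mul_add, pow_succ]
    simp only [mul_neg, mul_one, neg_mul]
    abel

end FormalResolvent

/-! ### Operator series acting on series, and formal differential equations. -/

section Action

open PowerSeries Finset

variable {A : Type*} [CommRing A] [Algebra ℝ A]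

lemma sum_antidiagonal_assoc {M : Type*} [AddCommMonoid M] (f : ℕ → ℕ → ℕ → M) (n : ℕ) :
    ∑ x ∈ antidiagonal n, ∑ y ∈ antidiagonal x.1, f y.1 y.2 x.2 =
      ∑ x ∈ antidiagonal n, ∑ y ∈ antidiagonal x.2, f x.1 y.1 y.2 := by
  rw [sum_sigma', sum_sigma']
  refine sum_nbij' (fun z => ⟨(z.2.1, z.2.2 + z.1.2), (z.2.2, z.1.2)⟩)
    (fun z => ⟨(z.1.1 + z.2.1, z.2.2), (z.1.1, z.2.1)⟩) ?_ ?_ ?_ ?_ ?_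
  all_goals
    rintro ⟨⟨i, j⟩, ⟨k, l⟩⟩ h
    simp only [mem_sigma, HasAntidiagonal.mem_antidiagonal] at h ⊢
  · exact ⟨by omega, trivial⟩
  · exact ⟨by omega, trivial⟩
  · obtain ⟨-, rfl⟩ := h
    rfl
  · obtain ⟨-, rfl⟩ := h
    rfl

/-- The Cauchy product of a series of operators with a series. -/
def cauchyAct (a : PowerSeries (Module.End ℝ A)) (F : PowerSeries A) : PowerSeries A :=
  mk fun N => ∑ ij ∈ antidiagonal N, coeff ij.1 a (coeff ij.2 F)

lemma coeff_cauchyAct (a : PowerSeries (Module.End ℝ A)) (F : PowerSeries A) (n : ℕ) :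
    coeff n (cauchyAct a F) = ∑ ij ∈ antidiagonal n, coeff ij.1 a (coeff ij.2 F) := coeff_mk _ _

/-- The action of formal series of operators on formal series, by the Cauchy product. -/
def act : PowerSeries (Module.End ℝ A) →+* Module.End ℝ (PowerSeries A) where
  toFun a :=
    { toFun := cauchyAct a
      map_add' := fun F F' => by ext; simp [coeff_cauchyAct, sum_add_distrib]
      map_smul' := fun c F => by ext; simp [coeff_cauchyAct, smul_sum] }
  map_zero' := LinearMap.ext fun F => PowerSeries.ext fun n => (coeff_cauchyAct _ _ _).trans <| by
    simp
  map_add' a a' := LinearMap.ext fun F => PowerSeries.ext fun n =>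
    (coeff_cauchyAct _ _ _).trans <| by
      change _ = coeff n (cauchyAct a F + cauchyAct a' F)
      simp [coeff_cauchyAct, sum_add_distrib]
  map_one' := LinearMap.ext fun F => PowerSeries.ext fun n => (coeff_cauchyAct _ _ _).trans <| by
    cases n with
    | zero => simp
    | succ n => simp [Nat.sum_antidiagonal_succ, coeff_one]
  map_mul' a b := LinearMap.ext fun F => PowerSeries.ext fun n =>
    (coeff_cauchyAct _ _ _).trans <| by
      change _ = coeff n (cauchyAct a (cauchyAct b F))
      simp only [coeff_cauchyAct, coeff_mul, LinearMap.sum_apply, Module.End.mul_apply, map_sum]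
      exact sum_antidiagonal_assoc (fun i j k => coeff i a (coeff j b (coeff k F))) n

lemma coeff_act (a : PowerSeries (Module.End ℝ A)) (F : PowerSeries A) (n : ℕ) :
    coeff n (act a F) = ∑ ij ∈ antidiagonal n, coeff ij.1 a (coeff ij.2 F) :=
  coeff_cauchyAct a F n

lemma coeff_zero_act (a : PowerSeries (Module.End ℝ A)) (F : PowerSeries A) :
    coeff 0 (act a F) = coeff 0 a (coeff 0 F) := by
  rw [coeff_act, Nat.antidiagonal_zero, sum_singleton]

lemma act_mul_apply (a b : PowerSeries (Module.End ℝ A)) (F : PowerSeries A) :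
    act (a * b) F = act a (act b F) := by rw [map_mul]; rfl

@[simp] lemma act_one_apply (F : PowerSeries A) : act 1 F = F := by rw [map_one]; rfl

lemma act_add_apply (a b : PowerSeries (Module.End ℝ A)) (F : PowerSeries A) :
    act (a + b) F = act a F + act b F := by rw [map_add]; rfl

lemma act_sub_apply (a b : PowerSeries (Module.End ℝ A)) (F : PowerSeries A) :
    act (a - b) F = act a F - act b F := by rw [map_sub]; rfl

lemma act_neg_apply (a : PowerSeries (Module.End ℝ A)) (F : PowerSeries A) :
    act (-a) F = -act a F := by rw [map_neg]; rfl

lemma coeff_act_C (a : PowerSeries (Module.End ℝ A)) (f : A) (n : ℕ) :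
    coeff n (act a (C f)) = coeff n a f := by
  rw [coeff_act]
  cases n with
  | zero => simp
  | succ n => simp [Nat.sum_antidiagonal_succ', coeff_C]

lemma coeff_act_C_left (a : Module.End ℝ A) (F : PowerSeries A) (n : ℕ) :
    coeff n (act (C a) F) = a (coeff n F) := by
  rw [coeff_act]
  cases n with
  | zero => simp
  | succ n => simp [Nat.sum_antidiagonal_succ, coeff_C]

lemma act_C_C (a : Module.End ℝ A) (f : A) : act (C a) (C f) = C (a f) := by
  ext n
  rw [coeff_act_C_left, coeff_C, coeff_C]
  split_ifs <;> simp

/-- Constant series already detect every coefficient of an operator series. -/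
lemma act_injective :
    Function.Injective (act : PowerSeries (Module.End ℝ A) → Module.End ℝ (PowerSeries A)) := by
  intro a b h
  ext n f : 2
  rw [← coeff_act_C, ← coeff_act_C, h]

lemma coeff_act_congr {a b : PowerSeries (Module.End ℝ A)} {F G : PowerSeries A} {n : ℕ}
    (h : ∀ k ≤ n, coeff k a = coeff k b) (h' : ∀ k ≤ n, coeff k F = coeff k G) :
    coeff n (act a F) = coeff n (act b G) := by
  rw [coeff_act, coeff_act]
  refine sum_congr rfl fun ij hij => ?_
  have := HasAntidiagonal.mem_antidiagonal.1 hij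
  rw [h _ (by omega), h' _ (by omega)]

/-- The derivative of a series of operators with respect to the parameter. -/
def opDeriv (a : PowerSeries (Module.End ℝ A)) : PowerSeries (Module.End ℝ A) :=
  mk fun n => ((n : ℝ) + 1) • coeff (n + 1) a

lemma coeff_derivative_smul (F : PowerSeries A) (n : ℕ) :
    coeff n (derivative A F) = ((n : ℝ) + 1) • coeff (n + 1) F := by
  rw [coeff_derivative, Algebra.smul_def, mul_comm]
  simp

/-- Split the weight as `n + 1 = i + j`; the terms with `i = 0` or `j = 0` drop out of the
respective sums. The bilinear map is general so that this covers both the action of operators and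
the bracket. -/
lemma sum_antidiagonal_leibniz {M N K : Type*} [AddCommGroup M] [Module ℝ M] [AddCommGroup N]
    [Module ℝ N] [AddCommGroup K] [Module ℝ K] (β : M →ₗ[ℝ] N →ₗ[ℝ] K) (a : ℕ → M) (b : ℕ → N)
    (n : ℕ) :
    ((n : ℝ) + 1) • ∑ ij ∈ antidiagonal (n + 1), β (a ij.1) (b ij.2) =
      (∑ ij ∈ antidiagonal n, β (((ij.1 : ℝ) + 1) • a (ij.1 + 1)) (b ij.2)) +
        ∑ ij ∈ antidiagonal n, β (a ij.1) (((ij.2 : ℝ) + 1) • b (ij.2 + 1)) := by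
  have h1 : ∑ ij ∈ antidiagonal n, β (((ij.1 : ℝ) + 1) • a (ij.1 + 1)) (b ij.2) =
      ∑ ij ∈ antidiagonal (n + 1), (ij.1 : ℝ) • β (a ij.1) (b ij.2) := by
    rw [Nat.sum_antidiagonal_succ]
    simp
  have h2 : ∑ ij ∈ antidiagonal n, β (a ij.1) (((ij.2 : ℝ) + 1) • b (ij.2 + 1)) =
      ∑ ij ∈ antidiagonal (n + 1), (ij.2 : ℝ) • β (a ij.1) (b ij.2) := by
    rw [Nat.sum_antidiagonal_succ']
    simp
  rw [h1, h2, ← sum_add_distrib, smul_sum]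
  refine sum_congr rfl fun ij hij => ?_
  rw [← add_smul, ← Nat.cast_add, HasAntidiagonal.mem_antidiagonal.1 hij]
  simp

lemma derivative_act (a : PowerSeries (Module.End ℝ A)) (F : PowerSeries A) :
    derivative A (act a F) = act (opDeriv a) F + act a (derivative A F) := by
  ext n
  rw [coeff_derivative_smul, coeff_act, map_add, coeff_act, coeff_act]
  simp only [coeff_derivative_smul, opDeriv, coeff_mk]
  exact sum_antidiagonal_leibniz (LinearMap.id : Module.End ℝ A →ₗ[ℝ] Module.End ℝ A)
    (fun i => coeff i a) (fun j => coeff j F) n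

/-- Uniqueness for systems of formal linear differential equations. -/
lemma eq_zero_of_derivative {ι : Type*} (E : ι → PowerSeries A) (h0 : ∀ i, coeff 0 (E i) = 0)
    (h : ∀ n, (∀ i, ∀ k ≤ n, coeff k (E i) = 0) → ∀ i, coeff n (derivative A (E i)) = 0) (i : ι) :
    E i = 0 := by
  have key (n : ℕ) : ∀ i, ∀ k ≤ n, coeff k (E i) = 0 := by
    induction n with
    | zero =>
      intro i k hk
      rw [Nat.le_zero.1 hk, h0]
    | succ n ih =>
      intro i k hk
      rcases Nat.lt_or_eq_of_le hk with hk | rfl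
      · exact ih i k (Nat.lt_succ_iff.1 hk)
      · have := h n ih i
        rw [coeff_derivative_smul] at this
        exact (smul_eq_zero.1 this).resolve_left (by positivity)
  ext n
  rw [key n i n le_rfl, map_zero]

lemma coeff_act_eq_zero {a : PowerSeries (Module.End ℝ A)} {F : PowerSeries A} {n : ℕ}
    (h : ∀ k ≤ n, coeff k F = 0) : coeff n (act a F) = 0 := by
  rw [coeff_act_congr (b := a) (G := 0) (fun _ _ => rfl) (by simpa using h), map_zero, map_zero]

variable {u v g : PowerSeries (Module.End ℝ A)}

lemma mul_eq_one_of_opDeriv (hu : opDeriv u = g * u) (hv : opDeriv v = -(v * g))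
    (hu0 : coeff 0 u = 1) (hv0 : coeff 0 v = 1) : v * u = 1 := by
  refine act_injective (LinearMap.ext fun F => sub_eq_zero.1 ?_)
  rw [act_mul_apply, act_one_apply]
  -- The family over all `F` is needed: the derivative of the defect at `F` is the defect at the
  -- derivative of `F`.
  refine eq_zero_of_derivative (fun F => act v (act u F) - F) (fun F => ?_) (fun n ih F => ?_) F
  · rw [map_sub, coeff_zero_act, coeff_zero_act, hu0, hv0, Module.End.one_apply,
      Module.End.one_apply, sub_self]
  · have h : derivative A (act v (act u F) - F) =
        act v (act u (derivative A F)) - derivative A F := by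
      rw [map_sub, derivative_act, derivative_act, hu, hv, act_neg_apply, act_mul_apply,
        act_mul_apply, map_add]
      abel
    rw [h]
    exact ih _ n le_rfl

lemma mul_eq_one_of_opDeriv' (hu : opDeriv u = g * u) (hv : opDeriv v = -(v * g))
    (hu0 : coeff 0 u = 1) (hv0 : coeff 0 v = 1) : u * v = 1 := by
  refine act_injective (LinearMap.ext fun F => sub_eq_zero.1 ?_)
  rw [act_mul_apply, act_one_apply]
  refine eq_zero_of_derivative (fun F => act u (act v F) - F) (fun F => ?_) (fun n ih F => ?_) F
  · rw [map_sub, coeff_zero_act, coeff_zero_act, hu0, hv0, Module.End.one_apply,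
      Module.End.one_apply, sub_self]
  -- In this order the generator does not cancel; the defect obeys a linear equation with the
  -- commutator of `g`.
  · have h : derivative A (act u (act v F) - F) =
        act g (act u (act v F) - F) - (act u (act v (act g F)) - act g F) +
          (act u (act v (derivative A F)) - derivative A F) := by
      rw [map_sub, derivative_act, derivative_act, hu, hv, act_neg_apply, act_mul_apply,
        act_mul_apply, map_add, map_sub, map_neg]
      abel
    rw [h, map_add, map_sub, coeff_act_eq_zero fun k hk => ih F k hk, ih _ n le_rfl, ih _ n le_rfl]
    simp

end Action

open PowerSeries Finset

/-- A Lie bracket with an averaging and an integrating operator for the Hamiltonian `h₀`. -/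
structure AveragedBracket (A : Type*) [CommRing A] [Algebra ℝ A] where
  /-- the bracket -/
  br : A →ₗ[ℝ] A →ₗ[ℝ] A
  /-- the unperturbed Hamiltonian -/
  h₀ : A
  /-- the averaging operator -/
  P : Module.End ℝ A
  /-- the integrating operator -/
  S : Module.End ℝ A
  br_swap : ∀ F G, br F G = -br G F
  br_leibniz : ∀ F K G, br (br F K) G = br (br F G) K + br F (br K G)
  P_br_h₀ : ∀ F, P (br F h₀) = 0
  br_h₀_P : ∀ F, br (P F) h₀ = 0
  S_br_h₀ : ∀ F, S (br F h₀) = F - P F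
  br_h₀_S : ∀ F, br (S F) h₀ = F - P F
  S_P : ∀ F, S (P F) = 0
  P_S : ∀ F, P (S F) = 0
  P_P : ∀ F, P (P F) = P F
  P_br : ∀ J, br J h₀ = 0 → ∀ F, P (br F J) = br (P F) J

namespace AveragedBracket

variable {A : Type*} [CommRing A] [Algebra ℝ A] (D : AveragedBracket A)

/-- `F` is an integral of motion of the unperturbed system. -/
def IsIntegral (F : A) : Prop := D.br F D.h₀ = 0

/-- The Liouville operator `L_G F = [F, G]`. -/
def L (G : A) : Module.End ℝ A := D.br.flip G

lemma L_apply (G F : A) : D.L G F = D.br F G := rfl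

lemma L_zero : D.L 0 = 0 := map_zero D.br.flip

lemma L_sum {ι : Type*} (s : Finset ι) (f : ι → A) : D.L (∑ i ∈ s, f i) = ∑ i ∈ s, D.L (f i) :=
  map_sum D.br.flip f s

/-! ### The bracket of formal series. -/

section SeriesBracket

/-- The Liouville operator of a formal series, as a formal series of operators. -/
def ell (K : PowerSeries A) : PowerSeries (Module.End ℝ A) := PowerSeries.mk fun n => D.L (coeff n K)

lemma coeff_ell (K : PowerSeries A) (n : ℕ) : coeff n (D.ell K) = D.L (coeff n K) := coeff_mk _ _

/-- The bracket of formal series. -/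
def sbr (F K : PowerSeries A) : PowerSeries A :=
  PowerSeries.mk fun n => ∑ ij ∈ antidiagonal n, D.br (coeff ij.1 F) (coeff ij.2 K)

/-- The perturbed Hamiltonian. -/
def ham (Hi : A) : PowerSeries A := C D.h₀ + X * C Hi

lemma coeff_sbr (F K : PowerSeries A) (n : ℕ) :
    coeff n (D.sbr F K) = ∑ ij ∈ antidiagonal n, D.br (coeff ij.1 F) (coeff ij.2 K) :=
  coeff_mk _ _

lemma act_ell (K F : PowerSeries A) : act (D.ell K) F = D.sbr F K := by
  ext1 n
  rw [coeff_act, coeff_sbr, ← Nat.sum_antidiagonal_swap]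
  simp only [coeff_ell, L_apply, Prod.fst_swap, Prod.snd_swap]

lemma sbr_swap (F K : PowerSeries A) : D.sbr F K = -D.sbr K F := by
  ext1 n
  rw [map_neg, coeff_sbr, coeff_sbr, ← Nat.sum_antidiagonal_swap, ← sum_neg_distrib]
  exact sum_congr rfl fun ij _ => D.br_swap _ _

lemma sbr_add_left (F F' K : PowerSeries A) :
    D.sbr (F + F') K = D.sbr F K + D.sbr F' K := by
  simp only [← act_ell, map_add]

lemma sbr_add_right (F K K' : PowerSeries A) :
    D.sbr F (K + K') = D.sbr F K + D.sbr F K' := by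
  rw [sbr_swap, sbr_add_left, neg_add, ← sbr_swap, ← sbr_swap]

lemma sbr_neg_right (F K : PowerSeries A) : D.sbr F (-K) = -D.sbr F K := by
  rw [sbr_swap, ← act_ell, map_neg, act_ell, ← sbr_swap]

lemma ell_sbr (K G : PowerSeries A) :
    D.ell (D.sbr K G) = D.ell G * D.ell K - D.ell K * D.ell G := by
  ext n f : 2
  rw [map_sub, LinearMap.sub_apply, coeff_mul, coeff_mul, coeff_ell, coeff_sbr,
    ← Nat.sum_antidiagonal_swap (n := n)
      (f := fun ij => coeff ij.1 (D.ell G) * coeff ij.2 (D.ell K))]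
  rw [L_sum, LinearMap.sum_apply, LinearMap.sum_apply, LinearMap.sum_apply, ← sum_sub_distrib]
  refine sum_congr rfl fun ij _ => ?_
  simp only [coeff_ell, Module.End.mul_apply, L_apply, Prod.fst_swap, Prod.snd_swap]
  rw [D.br_leibniz f]
  abel

lemma sbr_leibniz (F K G : PowerSeries A) :
    D.sbr (D.sbr F K) G = D.sbr (D.sbr F G) K + D.sbr F (D.sbr K G) := by
  rw [← act_ell _ (D.sbr K G), ell_sbr, act_sub_apply, act_mul_apply, act_mul_apply]
  simp only [act_ell]
  abel

lemma derivative_sbr (F K : PowerSeries A) :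
    derivative A (D.sbr F K) =
      D.sbr (derivative A F) K + D.sbr F (derivative A K) := by
  ext1 n
  rw [coeff_derivative_smul, map_add, coeff_sbr, coeff_sbr, coeff_sbr]
  simp only [coeff_derivative_smul]
  exact sum_antidiagonal_leibniz D.br (fun i => coeff i F) (fun j => coeff j K) n

lemma ell_ham (Hi : A) : D.ell (D.ham Hi) = C (D.L D.h₀) + X * C (D.L Hi) := by
  ext1 n
  rw [coeff_ell, ham, map_add, map_add]
  rcases n with _ | n
  · simp
  · rw [coeff_succ_X_mul, coeff_succ_X_mul, coeff_C, coeff_C, coeff_C, coeff_C]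
    split_ifs <;> simp_all [L_zero]

lemma derivative_ham (Hi : A) : derivative A (D.ham Hi) = C Hi := by
  ext1 n
  rw [coeff_derivative_smul, ham, map_add, coeff_succ_X_mul, coeff_C, coeff_C]
  rcases n with _ | n <;> simp

end SeriesBracket

/-! ### The Lie transform as an automorphism. -/

section LieTransform

/-- The coefficients of the Lie transform as linear operators. -/
def lieUCoeff (G : PowerSeries A) : ℕ → Module.End ℝ A
  | 0 => 1
  | n + 1 => ((n : ℝ) + 1)⁻¹ • ∑ k : Fin (n + 1), D.L (coeff (n - k) G) * lieUCoeff G k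

/-- The coefficients of the inverse Lie transform as linear operators. -/
def lieVCoeff (G : PowerSeries A) : ℕ → Module.End ℝ A
  | 0 => 1
  | n + 1 => -(((n : ℝ) + 1)⁻¹ • ∑ k : Fin (n + 1), lieVCoeff G k * D.L (coeff (n - k) G))

/-- The Lie transform as a formal series of operators. -/
def lieUSeries (G : PowerSeries A) : PowerSeries (Module.End ℝ A) := PowerSeries.mk (D.lieUCoeff G)

/-- The inverse Lie transform as a formal series of operators. -/
def lieVSeries (G : PowerSeries A) : PowerSeries (Module.End ℝ A) := PowerSeries.mk (D.lieVCoeff G)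

lemma coeff_zero_lieUSeries (G : PowerSeries A) : coeff 0 (D.lieUSeries G) = 1 := by
  rw [lieUSeries, coeff_mk, lieUCoeff]

lemma coeff_zero_lieVSeries (G : PowerSeries A) : coeff 0 (D.lieVSeries G) = 1 := by
  rw [lieVSeries, coeff_mk, lieVCoeff]

lemma opDeriv_lieUSeries (G : PowerSeries A) :
    opDeriv (D.lieUSeries G) = D.ell G * D.lieUSeries G := by
  ext1 n
  have h : ((n : ℝ) + 1) ≠ 0 := by positivity
  rw [opDeriv, coeff_mk, lieUSeries, coeff_mk, lieUCoeff, smul_inv_smul₀ h, coeff_mul,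
    ← Nat.sum_antidiagonal_swap, Nat.sum_antidiagonal_eq_sum_range_succ_mk, sum_range]
  simp only [Prod.fst_swap, Prod.snd_swap, coeff_ell, coeff_mk]

lemma opDeriv_lieVSeries (G : PowerSeries A) :
    opDeriv (D.lieVSeries G) = -(D.lieVSeries G * D.ell G) := by
  ext1 n
  have h : ((n : ℝ) + 1) ≠ 0 := by positivity
  rw [opDeriv, coeff_mk, lieVSeries, coeff_mk, lieVCoeff, smul_neg, smul_inv_smul₀ h, map_neg,
    coeff_mul, Nat.sum_antidiagonal_eq_sum_range_succ_mk, sum_range]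
  simp only [coeff_ell, coeff_mk]

lemma lieVSeries_mul_lieUSeries (G : PowerSeries A) : D.lieVSeries G * D.lieUSeries G = 1 :=
  mul_eq_one_of_opDeriv (D.opDeriv_lieUSeries G) (D.opDeriv_lieVSeries G)
    (D.coeff_zero_lieUSeries G) (D.coeff_zero_lieVSeries G)

lemma lieUSeries_mul_lieVSeries (G : PowerSeries A) : D.lieUSeries G * D.lieVSeries G = 1 :=
  mul_eq_one_of_opDeriv' (D.opDeriv_lieUSeries G) (D.opDeriv_lieVSeries G)
    (D.coeff_zero_lieUSeries G) (D.coeff_zero_lieVSeries G)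

/-- The Lie transform with generator `G`. -/
def lieU (G F : PowerSeries A) : PowerSeries A := act (D.lieUSeries G) F

/-- The inverse Lie transform with generator `G`. -/
def lieV (G F : PowerSeries A) : PowerSeries A := act (D.lieVSeries G) F

lemma act_lieUSeries (G F : PowerSeries A) : act (D.lieUSeries G) F = D.lieU G F := rfl

lemma act_lieVSeries (G F : PowerSeries A) : act (D.lieVSeries G) F = D.lieV G F := rfl

lemma lieU_lieV (G F : PowerSeries A) : D.lieU G (D.lieV G F) = F := by
  rw [← act_lieUSeries, ← act_lieVSeries, ← act_mul_apply, lieUSeries_mul_lieVSeries,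
    act_one_apply]

lemma lieV_lieU (G F : PowerSeries A) : D.lieV G (D.lieU G F) = F := by
  rw [← act_lieUSeries, ← act_lieVSeries, ← act_mul_apply, lieVSeries_mul_lieUSeries,
    act_one_apply]

lemma lieU_add (G F F' : PowerSeries A) : D.lieU G (F + F') = D.lieU G F + D.lieU G F' := by
  simp only [← act_lieUSeries, map_add]

lemma derivative_lieU (G F : PowerSeries A) :
    derivative A (D.lieU G F) =
      D.sbr (D.lieU G F) G + D.lieU G (derivative A F) := by
  rw [← act_lieUSeries, derivative_act, opDeriv_lieUSeries, act_mul_apply, act_ell, act_lieUSeries,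
    act_lieUSeries]

lemma derivative_lieV (G F : PowerSeries A) :
    derivative A (D.lieV G F) =
      D.lieV G (derivative A F - D.sbr F G) := by
  rw [← act_lieVSeries, derivative_act, opDeriv_lieVSeries, act_neg_apply, act_mul_apply, act_ell,
    neg_add_eq_sub, ← map_sub, act_lieVSeries]

/-- The Lie transform is an automorphism of the Poisson bracket. -/
lemma lieU_sbr (G F K : PowerSeries A) :
    D.lieU G (D.sbr F K) = D.sbr (D.lieU G F) (D.lieU G K) := by
  let E (FK : PowerSeries A × PowerSeries A) : PowerSeries A :=
    D.lieU G (D.sbr FK.1 FK.2) - D.sbr (D.lieU G FK.1) (D.lieU G FK.2)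
  have hE (F K : PowerSeries A) :
      E (F, K) = D.lieU G (D.sbr F K) - D.sbr (D.lieU G F) (D.lieU G K) := rfl
  refine sub_eq_zero.1 (eq_zero_of_derivative E (fun FK => ?_) (fun n ih FK => ?_) (F, K))
  · simp only [E, ← act_lieUSeries, map_sub, coeff_zero_act, coeff_zero_lieUSeries, coeff_sbr,
      Nat.antidiagonal_zero, sum_singleton, Module.End.one_apply, sub_self]
  · obtain ⟨F, K⟩ := FK
    -- The defects over all pairs form a closed homogeneous linear system, because bracketing with
    -- `G` is a derivation.
    have h : derivative A (E (F, K)) =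
        act (D.ell G) (E (F, K)) + E (derivative A F, K) + E (F, derivative A K) := by
      have h1 := D.derivative_lieU G (D.sbr F K)
      have h2 := D.derivative_sbr (D.lieU G F) (D.lieU G K)
      rw [derivative_sbr, lieU_add] at h1
      rw [derivative_lieU, derivative_lieU, sbr_add_left, sbr_add_right] at h2
      have h3 := D.sbr_leibniz (D.lieU G F) (D.lieU G K) G
      rw [hE, hE, hE, map_sub, map_sub, act_ell, act_ell, h1, h2, h3]
      abel
    rw [h, map_add, map_add, coeff_act_eq_zero (ih (F, K)), ih _ n le_rfl, ih _ n le_rfl, add_zero,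
      add_zero]

lemma sbr_lieV (G F K : PowerSeries A) :
    D.sbr F (D.lieV G K) = D.lieV G (D.sbr (D.lieU G F) K) := by
  rw [← D.lieV_lieU G (D.sbr F _), lieU_sbr, lieU_lieV]

lemma ell_lieV (G K : PowerSeries A) :
    D.ell (D.lieV G K) = D.lieVSeries G * D.ell K * D.lieUSeries G := by
  refine act_injective (LinearMap.ext fun F => ?_)
  rw [act_ell, sbr_lieV, act_mul_apply, act_mul_apply, act_ell, act_lieUSeries, act_lieVSeries]

end LieTransform

/-! ### Perturbed averaging and integrating operators. -/

section Kato

variable (Hi : A)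

/-- The Laurent coefficients of the perturbed resolvent. -/
def res (m : ℤ) : PowerSeries (Module.End ℝ A) := katoRes D.P D.S (D.L Hi) m

lemma coeff_res_apply (m : ℤ) (i : ℕ) (F : A) :
    coeff i (D.res Hi m) F =
      (-1 : ℝ) ^ i • zcoeff (katoSeries D.P D.S (D.L Hi) i) (m + i + 1) F := by
  rcases Nat.even_or_odd i with h | h
  · rw [h.neg_one_pow, one_smul]
    exact congrArg (fun T : Module.End ℝ A => T F) (coeff_katoRes_of_even D.P D.S (D.L Hi) m h)
  · rw [h.neg_one_pow, neg_one_smul]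
    exact congrArg (fun T : Module.End ℝ A => T F) (coeff_katoRes_of_odd D.P D.S (D.L Hi) m h)

/-- The perturbed averaging operator. -/
def PH (F : PowerSeries A) : PowerSeries A := act (-D.res Hi (-1)) F

/-- The perturbed integrating operator. -/
def SH (F : PowerSeries A) : PowerSeries A := act (D.res Hi 0) F

lemma PH_eq (F : PowerSeries A) : D.PH Hi F = -act (D.res Hi (-1)) F := act_neg_apply _ F

lemma act_res_zero (F : PowerSeries A) : act (D.res Hi 0) F = D.SH Hi F := rfl

lemma P_mul_L : D.P * D.L D.h₀ = 0 := LinearMap.ext D.P_br_h₀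

lemma L_mul_P : D.L D.h₀ * D.P = 0 := LinearMap.ext D.br_h₀_P

lemma S_mul_L : D.S * D.L D.h₀ = 1 - D.P := LinearMap.ext D.S_br_h₀

lemma L_mul_S : D.L D.h₀ * D.S = 1 - D.P := LinearMap.ext D.br_h₀_S

lemma S_mul_P : D.S * D.P = 0 := LinearMap.ext D.S_P

lemma P_mul_S : D.P * D.S = 0 := LinearMap.ext D.P_S

lemma P_mul_P : D.P * D.P = D.P := LinearMap.ext D.P_P

lemma res_mul_ell (m : ℤ) :
    D.res Hi m * D.ell (D.ham Hi) = D.res Hi (m - 1) + if m = 0 then 1 else 0 := by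
  rw [ell_ham]
  exact katoRes_mul D.P_mul_L D.S_mul_L D.S_mul_P _ m

lemma ell_mul_res (m : ℤ) :
    D.ell (D.ham Hi) * D.res Hi m = D.res Hi (m - 1) + if m = 0 then 1 else 0 := by
  rw [ell_ham]
  exact mul_katoRes D.L_mul_P D.L_mul_S D.P_mul_S _ m

/-- `L_H S_H = 1 - P_H`. -/
lemma sbr_SH_ham (F : PowerSeries A) : D.sbr (D.SH Hi F) (D.ham Hi) = F - D.PH Hi F := by
  rw [← act_ell, ← act_res_zero, ← act_mul_apply, ell_mul_res, PH_eq, if_pos rfl,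
    act_add_apply, act_one_apply, zero_sub, sub_neg_eq_add, add_comm]

/-- `P_H` commutes with `L_H`. -/
lemma sbr_PH_ham (F : PowerSeries A) :
    D.sbr (D.PH Hi F) (D.ham Hi) = D.PH Hi (D.sbr F (D.ham Hi)) := by
  rw [PH_eq, PH_eq, ← act_ell, ← act_ell, map_neg, ← act_mul_apply, ← act_mul_apply, ell_mul_res,
    res_mul_ell]

lemma PH_add (F F' : PowerSeries A) : D.PH Hi (F + F') = D.PH Hi F + D.PH Hi F' := by
  simp only [PH, map_add]

end Kato

/-! ### Normalization, intertwining and the Gustavson integral. -/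

section Normalization

variable (Hi : A) (F : PowerSeries A)

/-- The normalizing generator in the style `F`. -/
def gen : PowerSeries A := -D.SH Hi (C Hi) + D.PH Hi F

/-- The normalized Hamiltonian in the style `F`. -/
def normalizedHam : PowerSeries A := D.lieV (D.gen Hi F) (D.ham Hi)

/-- The Gustavson integral with seed `I₀`, in the style `F`. -/
def gustavson (I₀ : A) : PowerSeries A := D.lieU (D.gen Hi F) (C I₀)

/-- This is what the generator is chosen for: `-S_H Hi` leaves only `P_H Hi` of `Hi`, and the style
contributes a term already in the image of `P_H`. -/
lemma derivative_normalizedHam :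
    derivative A (D.normalizedHam Hi F) =
      D.lieV (D.gen Hi F) (D.PH Hi (C Hi + D.sbr F (D.ham Hi))) := by
  rw [normalizedHam, derivative_lieV, derivative_ham, sbr_swap, sub_neg_eq_add]
  congr 1
  rw [gen, sbr_add_left, sbr_PH_ham, PH_add, sbr_swap, sbr_neg_right, neg_neg, sbr_swap, sbr_SH_ham]
  abel

/-- The perturbed resolvent transported by the normalizing transform. -/
def normRes (m : ℤ) : PowerSeries (Module.End ℝ A) :=
  D.lieVSeries (D.gen Hi F) * D.res Hi m * D.lieUSeries (D.gen Hi F)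

lemma normRes_mul (m : ℤ) :
    D.normRes Hi F m * D.ell (D.normalizedHam Hi F) =
      D.normRes Hi F (m - 1) + if m = 0 then 1 else 0 := by
  have h := D.lieUSeries_mul_lieVSeries (D.gen Hi F)
  have h' := D.lieVSeries_mul_lieUSeries (D.gen Hi F)
  rw [normRes, normRes, normalizedHam, ell_lieV]
  set u := D.lieUSeries (D.gen Hi F)
  set v := D.lieVSeries (D.gen Hi F)
  calc v * D.res Hi m * u * (v * D.ell (D.ham Hi) * u)
      = v * D.res Hi m * (u * v) * D.ell (D.ham Hi) * u := by simp only [mul_assoc]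
    _ = v * (D.res Hi m * D.ell (D.ham Hi)) * u := by rw [h, mul_one, mul_assoc v]
    _ = _ := by
      rw [res_mul_ell]
      split_ifs
      · rw [mul_add, add_mul, mul_one, h']
      · rw [add_zero, add_zero]

/-- Conjugation by power series in `α` preserves divisibility by `X ^ (k + 1)`, hence the bound on
the pole order. -/
lemma coeff_normRes_eq_zero (k : ℕ) (m : ℤ) (h : m < -(k + 1)) :
    coeff k (D.normRes Hi F m) = 0 := by
  have h1 : X ^ (k + 1) ∣ D.res Hi m :=
    X_pow_dvd_iff.2 fun j hj => coeff_katoRes_eq_zero _ _ _ j m (by omega)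
  exact X_pow_dvd_iff.1 ((X_pow_dvd_mul_left h1 _).mul_right _) k k.lt_succ_self

lemma derivative_normalizedHam' :
    derivative A (D.normalizedHam Hi F) = act (-D.normRes Hi F (-1))
      (D.lieV (D.gen Hi F) (C Hi + D.sbr F (D.ham Hi))) := by
  rw [derivative_normalizedHam, PH_eq, act_neg_apply, normRes, act_mul_apply, act_mul_apply,
    act_lieUSeries, lieU_lieV, ← act_lieVSeries, map_neg]

lemma isIntegral_h₀ : D.IsIntegral D.h₀ := by
  have h : (2 : ℝ) • D.br D.h₀ D.h₀ = 0 := by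
    rw [two_smul]
    exact eq_neg_iff_add_eq_zero.1 (D.br_swap _ _)
  exact (smul_eq_zero.1 h).resolve_left two_ne_zero

lemma coeff_zero_normalizedHam : coeff 0 (D.normalizedHam Hi F) = D.h₀ := by
  rw [normalizedHam, ← act_lieVSeries, coeff_zero_act, coeff_zero_lieVSeries, Module.End.one_apply,
    ham, map_add, coeff_zero_X_mul, coeff_zero_C, add_zero]

lemma isIntegral_coeff_normalizedHam {n : ℕ}
    (h : ∀ k < n, coeff k (D.normRes Hi F (-1)) = coeff k (-C D.P)) :
    ∀ k ≤ n, D.IsIntegral (coeff k (D.normalizedHam Hi F)) := by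
  intro k hk
  cases k with
  | zero =>
    rw [coeff_zero_normalizedHam]
    exact D.isIntegral_h₀
  | succ k =>
    -- The coefficient at `k + 1` is read off from order `k` of the derivative, so agreement of the
    -- residue with `-P` strictly below `n` suffices through order `n`.
    have h1 := coeff_derivative_smul (D.normalizedHam Hi F) k
    rw [derivative_normalizedHam', coeff_act_congr (b := C D.P) (G := _)
      (fun j hj => by rw [map_neg, h j (by omega), map_neg, neg_neg]) (fun _ _ => rfl),
      coeff_act_C_left, eq_comm, ← eq_inv_smul_iff₀ (by positivity)] at h1
    rw [h1, ← map_smul]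
    exact D.br_h₀_P _

/-- The bootstrap: agreement below `n` makes the Hamiltonian's coefficients integrals through order
`n`, so `P` commutes with their Liouville operators and uniqueness of the residue gains one order.
-/
lemma coeff_normRes_neg_one (n : ℕ) :
    ∀ k < n, coeff k (D.normRes Hi F (-1)) = coeff k (-C D.P) := by
  induction n with
  | zero => intro k hk; exact absurd hk k.not_lt_zero
  | succ n ih =>
    intro k hk
    refine coeff_residue_eq D.L_mul_P D.L_mul_S D.P_mul_S D.P_mul_P
      (M := D.ell (D.normalizedHam Hi F)) (n := n) ?_ ?_ (D.normRes_mul Hi F)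
      (D.coeff_normRes_eq_zero Hi F) k (Nat.lt_succ_iff.1 hk)
    · rw [coeff_ell, coeff_zero_normalizedHam]
    · intro j hj
      rw [coeff_ell]
      exact LinearMap.ext (D.P_br _ (D.isIntegral_coeff_normalizedHam Hi F ih j hj))

lemma isIntegral_normalizedHam (n : ℕ) : D.IsIntegral (coeff n (D.normalizedHam Hi F)) :=
  D.isIntegral_coeff_normalizedHam Hi F (D.coeff_normRes_neg_one Hi F n) n le_rfl

/-- The Lie transform intertwines the unperturbed and the perturbed averaging operators. -/
lemma PH_lieU (K : PowerSeries A) :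
    D.PH Hi (D.lieU (D.gen Hi F) K) = D.lieU (D.gen Hi F) (act (C D.P) K) := by
  have h : -D.normRes Hi F (-1) = C D.P := by
    ext1 n
    rw [map_neg, D.coeff_normRes_neg_one Hi F (n + 1) n n.lt_succ_self, map_neg, neg_neg]
  rw [← h, act_neg_apply, normRes, act_mul_apply, act_mul_apply, PH_eq]
  have h' := D.lieU_lieV (D.gen Hi F) (act (D.res Hi (-1)) (D.lieU (D.gen Hi F) K))
  rw [← act_lieUSeries, ← act_lieVSeries] at h'
  rw [← act_lieUSeries _ _ (-_), map_neg]
  exact (congrArg Neg.neg h').symm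

variable {I₀ : A}

lemma sbr_C_eq_zero {K : PowerSeries A} (h : ∀ n, D.br I₀ (coeff n K) = 0) :
    D.sbr (C I₀) K = 0 := by
  ext1 n
  rw [sbr_swap, ← act_ell, ell, map_neg, coeff_act]
  rw [map_zero, neg_eq_zero]
  refine sum_eq_zero fun ij _ => ?_
  rw [coeff_mk, L_apply, coeff_C]
  split_ifs
  · rw [br_swap, h, neg_zero]
  · exact map_zero _

/-- By intertwining, `P_H K = U_G P V_G K`, so the bracket is the image under `U_G` of the seed's
bracket with integrals. -/
lemma sbr_gustavson_PH (hI₀ : ∀ J, D.IsIntegral J → D.br I₀ J = 0) (K : PowerSeries A) :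
    D.sbr (D.gustavson Hi F I₀) (D.PH Hi K) = 0 := by
  rw [← D.lieU_lieV (D.gen Hi F) K, PH_lieU, gustavson, ← lieU_sbr, sbr_C_eq_zero,
    ← act_lieUSeries, map_zero]
  intro n
  rw [coeff_act_C_left]
  exact hI₀ _ (D.br_h₀_P _)

lemma derivative_gustavson (hI₀ : ∀ J, D.IsIntegral J → D.br I₀ J = 0) :
    derivative A (D.gustavson Hi F I₀) =
      -(D.sbr (D.gustavson Hi F I₀) (D.SH Hi (C Hi))) := by
  have h := D.derivative_lieU (D.gen Hi F) (C I₀)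
  rw [derivative_C, ← act_lieUSeries _ _ 0, map_zero, add_zero] at h
  rw [← sbr_neg_right, ← add_zero (D.sbr _ (-_)), ← D.sbr_gustavson_PH Hi F hI₀ F,
    ← sbr_add_right]
  exact h

lemma sbr_C_normalizedHam (hI₀ : ∀ J, D.IsIntegral J → D.br I₀ J = 0) :
    D.sbr (C I₀) (D.normalizedHam Hi F) = 0 :=
  D.sbr_C_eq_zero fun n => hI₀ _ (D.isIntegral_normalizedHam Hi F n)

lemma PH_gustavson (hI₀ : D.P I₀ = I₀) :
    D.PH Hi (D.gustavson Hi F I₀) = D.gustavson Hi F I₀ := by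
  rw [gustavson, PH_lieU, act_C_C, hI₀]

lemma sbr_gustavson_ham (hI₀ : ∀ J, D.IsIntegral J → D.br I₀ J = 0) :
    D.sbr (D.gustavson Hi F I₀) (D.ham Hi) = 0 := by
  rw [← D.lieU_lieV (D.gen Hi F) (D.ham Hi), gustavson, ← lieU_sbr]
  have h := D.sbr_C_normalizedHam Hi F hI₀
  rw [normalizedHam] at h
  rw [h, ← act_lieUSeries, map_zero]

/-- The difference solves a homogeneous linear equation with zero initial value. -/
lemma gustavson_eq_gustavson (F' : PowerSeries A) (hI₀ : ∀ J, D.IsIntegral J → D.br I₀ J = 0) :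
    D.gustavson Hi F I₀ = D.gustavson Hi F' I₀ := by
  refine sub_eq_zero.1 (eq_zero_of_derivative
    (fun _ : Unit => D.gustavson Hi F I₀ - D.gustavson Hi F' I₀) (fun _ => ?_) (fun n ih _ => ?_) ())
  · rw [map_sub, gustavson, gustavson, ← act_lieUSeries, ← act_lieUSeries, coeff_zero_act,
      coeff_zero_act, coeff_zero_lieUSeries, coeff_zero_lieUSeries, sub_self]
  · rw [map_sub, derivative_gustavson D Hi F hI₀, derivative_gustavson D Hi F' hI₀, ← act_ell,
      ← act_ell, neg_sub_neg, ← neg_sub, ← map_sub, map_neg, coeff_act_eq_zero (ih ()), neg_zero]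

end Normalization

end AveragedBracket

/-! ### Identification of the abstract operators with the concrete ones. -/

namespace UnperturbedSystem

open PowerSeries Finset

variable {d : ℕ} (sys : UnperturbedSystem d)

/-- The bracket, averaging and integrating operators of an unperturbed system. -/
def averagedBracket : AveragedBracket sys.Obs where
  br := sys.brₗ
  h₀ := sys.h₀
  P := sys.Pₗ
  S := sys.Sₗ
  br_swap := sys.br_swap
  br_leibniz := sys.br_leibniz
  P_br_h₀ := sys.P_L_h₀
  br_h₀_P := sys.L_h₀_P
  S_br_h₀ := sys.S_L_h₀
  br_h₀_S := sys.L_h₀_S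
  S_P := sys.S_P
  P_S := sys.P_S
  P_P := sys.P_P
  P_br := fun _ h => sys.P_br_of_isIntegral h

lemma averagedBracket_ham (Hi : sys.Obs) : sys.averagedBracket.ham Hi = sys.ham Hi := rfl

lemma lieUCoeff_apply (G : sys.Series) (n : ℕ) (F : sys.Obs) :
    sys.averagedBracket.lieUCoeff G n F = sys.depritU G n F := by
  induction n using Nat.strong_induction_on with
  | _ n ih =>
    cases n with
    | zero => rw [AveragedBracket.lieUCoeff, depritU, Module.End.one_apply]
    | succ n =>
      rw [AveragedBracket.lieUCoeff, depritU, LinearMap.smul_apply, LinearMap.sum_apply]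
      refine congrArg (fun x : sys.Obs => ((n : ℝ) + 1)⁻¹ • x) (sum_congr rfl fun k _ => ?_)
      rw [Module.End.mul_apply, ih k k.2]
      rfl

lemma lieVCoeff_apply (G : sys.Series) (n : ℕ) (F : sys.Obs) :
    sys.averagedBracket.lieVCoeff G n F = sys.depritV G n F := by
  induction n using Nat.strong_induction_on generalizing F with
  | _ n ih =>
    cases n with
    | zero => rw [AveragedBracket.lieVCoeff, depritV, Module.End.one_apply]
    | succ n =>
      rw [AveragedBracket.lieVCoeff, depritV, LinearMap.neg_apply, LinearMap.smul_apply,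
        LinearMap.sum_apply]
      refine congrArg (fun x : sys.Obs => -(((n : ℝ) + 1)⁻¹ • x)) (sum_congr rfl fun k _ => ?_)
      rw [Module.End.mul_apply, ih k k.2]
      rfl

lemma averagedBracket_lieU (G F : sys.Series) : sys.averagedBracket.lieU G F = sys.lieU G F := by
  ext1 n
  rw [← AveragedBracket.act_lieUSeries, coeff_act, lieU, coeff_mk]
  refine sum_congr rfl fun ij _ => ?_
  rw [AveragedBracket.lieUSeries, coeff_mk, lieUCoeff_apply]

lemma averagedBracket_lieV (G F : sys.Series) : sys.averagedBracket.lieV G F = sys.lieV G F := by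
  ext1 n
  rw [← AveragedBracket.act_lieVSeries, coeff_act, lieV, coeff_mk]
  refine sum_congr rfl fun ij _ => ?_
  rw [AveragedBracket.lieVSeries, coeff_mk, lieVCoeff_apply]

section Kato

variable (Hi : sys.Obs)

/-- Words are built from the outermost factor, whereas splitting off the first entry of a tuple
removes the innermost one; this reconciles the two. -/
lemma katoWord_succ' (n : ℕ) (p : Fin (n + 2) → ℕ) (F : sys.Obs) :
    sys.katoWord Hi (n + 1) p F =
      sys.katoWord Hi n (Fin.tail p) (sys.L Hi (sys.Sr (p 0) F)) := by
  induction n with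
  | zero => rfl
  | succ n ih =>
    rw [katoWord, ih, katoWord]
    rfl

lemma sum_antidiagonalTuple_succ {M : Type*} [AddCommMonoid M] (n s : ℕ)
    (f : (Fin (n + 1) → ℕ) → M) :
    ∑ p ∈ Nat.antidiagonalTuple (n + 1) s, f p =
      ∑ ab ∈ antidiagonal s, ∑ p ∈ Nat.antidiagonalTuple n ab.2, f (Fin.cons ab.1 p) := by
  rw [sum_sigma']
  refine sum_nbij' (fun p => ⟨(p 0, ∑ i, Fin.tail p i), Fin.tail p⟩)
    (fun z => Fin.cons z.1.1 z.2) ?_ ?_ ?_ ?_ ?_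
  · intro p hp
    rw [Nat.mem_antidiagonalTuple, Fin.sum_univ_succ] at hp
    simp only [mem_sigma, HasAntidiagonal.mem_antidiagonal, Nat.mem_antidiagonalTuple]
    exact ⟨hp, trivial⟩
  · rintro ⟨⟨a, b⟩, p⟩ hp
    simp only [mem_sigma, HasAntidiagonal.mem_antidiagonal, Nat.mem_antidiagonalTuple] at hp
    simp [Nat.mem_antidiagonalTuple, Fin.sum_univ_succ, hp]
  · intro p _
    exact Fin.cons_self_tail p
  · rintro ⟨⟨a, b⟩, p⟩ hp
    simp only [mem_sigma, HasAntidiagonal.mem_antidiagonal, Nat.mem_antidiagonalTuple] at hp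
    simp [hp]
  · intro p _
    rw [Fin.cons_self_tail]

lemma coeff_resolventSeries (k : ℕ) (F : sys.Obs) :
    coeff k (resolventSeries sys.averagedBracket.P sys.averagedBracket.S) F = sys.Sr k F := by
  rw [resolventSeries, coeff_mk, Sr]
  split_ifs
  · rfl
  · rw [Module.End.pow_apply]
    rfl

lemma coeff_katoSeries (n s : ℕ) (F : sys.Obs) :
    coeff s (katoSeries sys.averagedBracket.P sys.averagedBracket.S (sys.averagedBracket.L Hi) n) F =
      sys.katoSum Hi n s F := by
  induction n generalizing s F with
  | zero =>
    rw [katoSeries, pow_zero, mul_one, coeff_resolventSeries, katoSum, Nat.antidiagonalTuple_one,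
      sum_singleton, katoWord]
    rfl
  | succ n ih =>
    rw [katoSeries_succ, coeff_mul, katoSum, sum_antidiagonalTuple_succ,
      ← Nat.sum_antidiagonal_swap, LinearMap.sum_apply]
    refine sum_congr rfl fun ab _ => ?_
    simp only [Prod.fst_swap, Prod.snd_swap, katoWord_succ', Fin.tail_cons, Fin.cons_zero]
    rw [Module.End.mul_apply, ih, coeff_C_mul, Module.End.mul_apply, coeff_resolventSeries]
    rfl

lemma averagedBracket_PH (F : sys.Series) : sys.averagedBracket.PH Hi F = sys.PH Hi F := by
  ext1 n
  rw [AveragedBracket.PH_eq, map_neg, coeff_act, PH, coeff_mk, ← sum_neg_distrib]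
  refine sum_congr rfl fun ij _ => ?_
  have e : (-1 : ℤ) + ij.1 + 1 = ij.1 := by ring
  rw [AveragedBracket.coeff_res_apply, e, zcoeff_natCast, coeff_katoSeries, pow_succ, mul_neg_one, neg_smul]

lemma averagedBracket_SH (F : sys.Series) : sys.averagedBracket.SH Hi F = sys.SH Hi F := by
  ext1 n
  rw [← AveragedBracket.act_res_zero, coeff_act, SH, coeff_mk]
  refine sum_congr rfl fun ij _ => ?_
  have e : (0 : ℤ) + ij.1 + 1 = (ij.1 + 1 : ℕ) := by push_cast; ring
  rw [AveragedBracket.coeff_res_apply, e, zcoeff_natCast, coeff_katoSeries]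

lemma averagedBracket_gen (F : sys.Series) : sys.averagedBracket.gen Hi F = sys.gen Hi F := by
  rw [AveragedBracket.gen, gen, averagedBracket_SH, averagedBracket_PH]

lemma averagedBracket_normalizedHam (F : sys.Series) :
    sys.averagedBracket.normalizedHam Hi F = sys.normalizedHam Hi F := by
  rw [AveragedBracket.normalizedHam, normalizedHam, averagedBracket_gen, averagedBracket_ham,
    averagedBracket_lieV]

lemma averagedBracket_gustavson (F : sys.Series) (I₀ : sys.Obs) :
    sys.averagedBracket.gustavson Hi F I₀ = sys.gustavson Hi F I₀ := by
  rw [AveragedBracket.gustavson, gustavson, averagedBracket_gen, averagedBracket_lieU]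

end Kato

end UnperturbedSystem

end KatoMech

end

theorem mainTheorem5 (d : ℕ) (sys : KatoMech.UnperturbedSystem d) (Hi : sys.Obs) (I₀ : sys.Obs)
    (hI₀ : sys.IsCentralIntegral I₀) :
    -- the seed is secular and commutes with all secular functions
    sys.P I₀ = I₀ ∧
    (∀ K : sys.Obs, sys.br I₀ (sys.P K) = 0) ∧
    -- in every normalization style `F`
    (∀ F : sys.Series,
      -- the seed commutes with the normalized Hamiltonian
      sys.sbr (PowerSeries.C I₀) (sys.normalizedHam Hi F) = 0 ∧
      -- the Gustavson integral lies in the image of `P_H` and commutes with that image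
      sys.gustavson Hi F I₀ = sys.PH Hi (sys.gustavson Hi F I₀) ∧
      (∀ K : sys.Series, sys.sbr (sys.gustavson Hi F I₀) (sys.PH Hi K) = 0) ∧
      -- it is a formal integral of the perturbed system
      sys.sbr (sys.gustavson Hi F I₀) (sys.ham Hi) = 0 ∧
      -- its derivative with respect to `α` does not involve `F`
      PowerSeries.derivative sys.Obs (sys.gustavson Hi F I₀) =
        -(sys.sL (sys.SH Hi (PowerSeries.C Hi)) (sys.gustavson Hi F I₀))) ∧
    -- it does not depend on the normalization style
    (∀ F F' : sys.Series, sys.gustavson Hi F I₀ = sys.gustavson Hi F' I₀) := by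
  have hP : sys.P I₀ = I₀ := sys.P_eq_self_iff.2 hI₀.1
  have hC : ∀ J, sys.averagedBracket.IsIntegral J → sys.averagedBracket.br I₀ J = 0 := hI₀.2
  refine ⟨hP, fun K => hI₀.2 _ (sys.isIntegral_P K), fun F => ⟨?_, ?_, fun K => ?_, ?_, ?_⟩,
    fun F F' => ?_⟩
  · rw [← sys.averagedBracket_normalizedHam]
    exact sys.averagedBracket.sbr_C_normalizedHam Hi F hC
  · rw [← sys.averagedBracket_gustavson, ← sys.averagedBracket_PH]
    exact (sys.averagedBracket.PH_gustavson Hi F hP).symm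
  · rw [← sys.averagedBracket_gustavson, ← sys.averagedBracket_PH]
    exact sys.averagedBracket.sbr_gustavson_PH Hi F hC K
  · rw [← sys.averagedBracket_gustavson]
    exact sys.averagedBracket.sbr_gustavson_ham Hi F hC
  · rw [← sys.averagedBracket_gustavson, ← sys.averagedBracket_SH]
    exact sys.averagedBracket.derivative_gustavson Hi F hC
  · rw [← sys.averagedBracket_gustavson, ← sys.averagedBracket_gustavson]
    exact sys.averagedBracket.gustavson_eq_gustavson Hi F F' hC
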